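/- Let $P$ be a non-self-intersecting rectilinear polygon in the plane, possibly with holes; each hole is a hole-free non-self-intersecting rectilinear polygon strictly contained in $P$, and any two holes meet at most in one common vertex. From every concave vertex of $P$ (including the vertices of holes; convexity is with respect to the interior of $P$) extend one horizontal and one vertical ray through the interior of $P$ until it meets an edge. The cells into which these rays cut the interior of $P$ are the \emph{base rectangles} of $P$; $\mathcal{B}(P)$ denotes their set. The \emph{base rectangle graph} $G^*(P)$ has the base rectangles as nodes, and each node has up to four labelled neighbors (left, top, right, bottom), namely the base rectangles with which it shares its left, top, right, or bottom edge. For a set $\mathcal{R}$ of rectangles, the \emph{rectangle powerset} $\Gamma(\mathcal{R})$ is the set of all (nondegenerate, axis-parallel) rectangles that are the union of a subset of $\mathcal{R}$. Then, given $G^*(P)$, the powerset $\Gamma(\mathcal{B}(P))$ can be reported in $O(|\Gamma(\mathcal{B}(P))|)$ time. Precisely, there are a program for a unit-cost random access machine (with integer and real registers and memory; the reals are only moved, compared and reported, and integers are only increased by constants) and a constant $C$ such that for every such $P$ the following holds. Whenever the memory contains $G^*(P)$ as an arbitrarily ordered array of records, one for each base rectangle, holding its coordinates and pointers to its neighbors,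 the program halts after at most $C\cdot(|\Gamma(\mathcal{B}(P))|+1)$ steps and has then reported every rectangle of $\Gamma(\mathcal{B}(P))$, given by its top-left and bottom-right vertex, exactly once, and nothing else. -/

import Mathlib

noncomputable section

namespace RectCover

/-! ### Rectilinear polygons -/

/-- The horizontal edge from `(x i, y i)` to `(x (i+1), y i)`, indices being cyclic. -/
def hEdge {n : ℕ} (x y : Fin n → ℝ) (i : Fin n) : Set (ℝ × ℝ) :=
  segment ℝ (x i, y i) (x (finRotate n i), y i)

/-- The vertical edge from `(x (i+1), y i)` to `(x (i+1), y (i+1))`, indices being cyclic. -/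
def vEdge {n : ℕ} (x y : Fin n → ℝ) (i : Fin n) : Set (ℝ × ℝ) :=
  segment ℝ (x (finRotate n i), y i) (x (finRotate n i), y (finRotate n i))

/-- A hole-free, non-self-intersecting rectilinear polygon with `n` horizontal and `n` vertical
edges. Its cyclic list of edges alternates between the horizontal edges `hEdge x y i` and the
vertical edges `vEdge x y i`; edges are nondegenerate, and non-adjacent edges are disjoint. -/
structure SimplePolygon where
  n : ℕ
  n_pos : 0 < n
  x : Fin n → ℝ
  y : Fin n → ℝ
  x_ne : ∀ i, x i ≠ x (finRotate n i)
  y_ne : ∀ i, y i ≠ y (finRotate n i)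
  hEdge_disjoint : ∀ i j, i ≠ j → Disjoint (hEdge x y i) (hEdge x y j)
  vEdge_disjoint : ∀ i j, i ≠ j → Disjoint (vEdge x y i) (vEdge x y j)
  hEdge_vEdge_disjoint : ∀ i j, j ≠ i → finRotate n j ≠ i →
    Disjoint (hEdge x y i) (vEdge x y j)

namespace SimplePolygon

variable (c : SimplePolygon)

/-- The union of all edges. -/
def boundary : Set (ℝ × ℝ) :=
  (⋃ i, hEdge c.x c.y i) ∪ ⋃ i, vEdge c.x c.y i

/-- The open bounded region enclosed by the edges, by the even-odd rule: the points off the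
boundary whose upward vertical ray crosses an odd number of horizontal edges (an edge counts if
exactly one of its endpoints has abscissa at most that of the point). -/
def inside : Set (ℝ × ℝ) :=
  {q | q ∉ c.boundary ∧
    Odd {i | q.2 < c.y i ∧ ¬(c.x i ≤ q.1 ↔ c.x (finRotate c.n i) ≤ q.1)}.ncard}

/-- The enclosed region together with the boundary. -/
def closedRegion : Set (ℝ × ℝ) := c.inside ∪ c.boundary

/-- `u`, `v`, `w` are three consecutive vertices. -/
def Consecutive (u v w : ℝ × ℝ) : Prop :=
  ∃ i : Fin c.n,
    (u = (c.x i, c.y i) ∧ v = (c.x (finRotate c.n i), c.y i) ∧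
      w = (c.x (finRotate c.n i), c.y (finRotate c.n i))) ∨
    (u = (c.x (finRotate c.n i), c.y i) ∧
      v = (c.x (finRotate c.n i), c.y (finRotate c.n i)) ∧
      w = (c.x (finRotate c.n (finRotate c.n i)), c.y (finRotate c.n i)))

def vertices : Set (ℝ × ℝ) := {v | ∃ u w, c.Consecutive u v w}

end SimplePolygon

/-- A non-self-intersecting rectilinear polygon with finitely many holes. Every hole is strictly
contained in the outer polygon, and two holes meet at most in one common vertex. -/
structure Polygon where
  outer : SimplePolygon
  numHoles : ℕ
  hole : Fin numHoles → SimplePolygon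
  hole_ssubset : ∀ i, (hole i).inside ⊂ outer.inside
  hole_inter : ∀ i j, i ≠ j →
    ((hole i).closedRegion ∩ (hole j).closedRegion).Subsingleton ∧
    (hole i).closedRegion ∩ (hole j).closedRegion ⊆ (hole i).vertices ∩ (hole j).vertices

/-! ### Rectangles and rectangle powersets -/

/-- A nondegenerate axis-parallel rectangle; the second coordinate axis points upwards. -/
@[ext]
structure Rect where
  left : ℝ
  top : ℝ
  right : ℝ
  bottom : ℝ
  left_lt_right : left < right
  bottom_lt_top : bottom < top

namespace Rect

def closedBox (R : Rect) : Set (ℝ × ℝ) := Set.Icc R.left R.right ×ˢ Set.Icc R.bottom R.top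

def openBox (R : Rect) : Set (ℝ × ℝ) := Set.Ioo R.left R.right ×ˢ Set.Ioo R.bottom R.top

/-- The representation of a rectangle by its top-left and its bottom-right vertex. -/
def toPair (R : Rect) : (ℝ × ℝ) × (ℝ × ℝ) := ((R.left, R.top), (R.right, R.bottom))

end Rect

/-- The rectangle powerset: all rectangles that are covered by a subset of `𝓡`, a cover being a
family of rectangles whose union is exactly the covered rectangle. -/
def powerset (𝓡 : Set Rect) : Set Rect :=
  {R | ∃ S ⊆ 𝓡, R.closedBox = ⋃ B ∈ S, B.closedBox}

/-! ### Base rectangles -/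

namespace Polygon

variable (P : Polygon)

/-- The outer boundary polygon and the holes. -/
def components : Set SimplePolygon := insert P.outer (Set.range P.hole)

/-- The inner points: enclosed by the outer polygon, off all edges, and in no hole. -/
def inner : Set (ℝ × ℝ) := {q | q ∈ P.outer.inside ∧ ∀ i, q ∉ (P.hole i).closedRegion}

/-- The interior angle at `v`, between the edges from `v` to `u` and to `w`, is `π / 2`: close to
`v` the quadrant spanned by the two edges consists of inner points. -/
def ConvexAt (u v w : ℝ × ℝ) : Prop :=
  ∃ ε > 0, ∀ s ∈ Set.Ioo (0 : ℝ) ε, ∀ t ∈ Set.Ioo (0 : ℝ) ε,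
    v + s • (u - v) + t • (w - v) ∈ P.inner

/-- `v` is a concave vertex of the polygon or of a hole, with respect to the interior of `P`. -/
def IsConcaveVertex (v : ℝ × ℝ) : Prop :=
  ∃ c ∈ P.components, ∃ u w, c.Consecutive u v w ∧ ¬ P.ConvexAt u v w

/-- The ray that starts at `v` in direction `d` and runs through the interior of `P` until it meets
an edge (endpoints excluded). It is empty if direction `d` does not lead into the interior. -/
def ray (v d : ℝ × ℝ) : Set (ℝ × ℝ) :=
  {q | ∃ t > (0 : ℝ), q = v + t • d ∧ ∀ s ∈ Set.Ioc (0 : ℝ) t, v + s • d ∈ P.inner}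

/-- The union of the horizontal and vertical rays of all concave vertices. At a concave vertex two
of the four directions run along the edges at that vertex and yield empty rays, which leaves one
horizontal and one vertical ray. -/
def cuts : Set (ℝ × ℝ) :=
  {q | ∃ v, P.IsConcaveVertex v ∧
    ∃ d ∈ ({(1, 0), (-1, 0), (0, 1), (0, -1)} : Set (ℝ × ℝ)), q ∈ P.ray v d}

/-- The base rectangles: the cells (connected components) into which the rays cut the interior. -/
def baseRectangles : Set Rect :=
  {R | ∃ q ∈ P.inner \ P.cuts, connectedComponentIn (P.inner \ P.cuts) q = R.openBox}

end Polygon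

/-! ### The base rectangle graph and its representation in memory -/

/-- The four labels of neighbors in the base rectangle graph. -/
inductive Side
  | left
  | top
  | right
  | bottom

/-- `B` shares its edge on the side `s` with `B'`, i.e. `B'` lies on that side of `B` and this edge
of `B` is the opposite edge of `B'`. -/
def Rect.SharesEdge : Side → Rect → Rect → Prop
  | .left, B, B' => B'.right = B.left ∧ B'.bottom = B.bottom ∧ B'.top = B.top
  | .top, B, B' => B'.bottom = B.top ∧ B'.left = B.left ∧ B'.right = B.right
  | .right, B, B' => B'.left = B.right ∧ B'.bottom = B.bottom ∧ B'.top = B.top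
  | .bottom, B, B' => B'.top = B.bottom ∧ B'.left = B.left ∧ B'.right = B.right

/-- Position of a side in a record: left, top, right, bottom. -/
def Side.offset : Side → ℕ
  | .left => 0
  | .top => 1
  | .right => 2
  | .bottom => 3

/-- The coordinate of a side of a rectangle. -/
def Rect.coord (R : Rect) : Side → ℝ
  | .left => R.left
  | .top => R.top
  | .right => R.right
  | .bottom => R.bottom

/-- The address of the record of the `j`-th node; `0` is no such address and serves as null. -/
def address (j : ℕ) : ℕ := 4 * j + 1

/-- The memory contains the base rectangle graph of `P`. Cell `0` holds the number `N` of nodes. The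
nodes are the base rectangles in an arbitrary order, without repetitions. The record of a node
occupies the four cells from its address on: the real memory holds its four coordinates, the
integer memory holds the addresses of its left, top, right and bottom neighbors, or null where there
is no such neighbor. All other cells are arbitrary. -/
def StoresBaseRectangleGraph (P : Polygon) (ints : ℕ → ℕ) (reals : ℕ → ℝ) : Prop :=
  ∃ (N : ℕ) (node : Fin N → Rect),
    ints 0 = N ∧ Function.Injective node ∧ Set.range node = P.baseRectangles ∧
    ∀ (j : Fin N) (s : Side),
      reals (address j + s.offset) = (node j).coord s ∧
      ((∃ j' : Fin N, (node j).SharesEdge s (node j') ∧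
          ints (address j + s.offset) = address j') ∨
        ((∀ j' : Fin N, ¬ (node j).SharesEdge s (node j')) ∧
          ints (address j + s.offset) = 0))

/-! ### Random access machines -/

/-- Instructions of a random access machine with integer and real registers and an integer and a real
memory, each of unit cost. Reals can only be moved, compared and reported, and integers only be
increased by constants, so they exceed those in the input by at most a constant times the running
time. Registers, constants and jump targets are part of the program.
Below, `I` and `X` are the integer and the real registers. -/
inductive Instr
  /-- `I[d] := k` -/
  | const (d k : ℕ)
  /-- `I[d] := I[a] + k` -/
  | addConst (d a k : ℕ)
  /-- `I[d] := ints[I[a] + k]` -/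
  | load (d a k : ℕ)
  /-- `ints[I[a] + k] := I[b]` -/
  | store (a k b : ℕ)
  /-- `X[d] := X[a]` -/
  | moveReal (d a : ℕ)
  /-- `X[d] := reals[I[a] + k]` -/
  | loadReal (d a k : ℕ)
  /-- `reals[I[a] + k] := X[b]` -/
  | storeReal (a k b : ℕ)
  /-- go to instruction `l` -/
  | jump (l : ℕ)
  /-- go to instruction `l` if `I[a] = I[b]` -/
  | jumpEq (a b l : ℕ)
  /-- go to instruction `l` if `I[a] < I[b]` -/
  | jumpLt (a b l : ℕ)
  /-- go to instruction `l` if `X[a] = X[b]` -/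
  | jumpRealEq (a b l : ℕ)
  /-- go to instruction `l` if `X[a] < X[b]` -/
  | jumpRealLt (a b l : ℕ)
  /-- report the rectangle with top-left vertex `(X[a], X[b])`, bottom-right vertex `(X[c], X[d])` -/
  | report (a b c d : ℕ)

/-- A program is a finite list of instructions, numbered from `0`. -/
abbrev Program := List Instr

/-- A configuration of the machine; `output` lists what has been reported, latest first. -/
structure Config where
  pc : ℕ
  intReg : ℕ → ℕ
  realReg : ℕ → ℝ
  ints : ℕ → ℕ
  reals : ℕ → ℝ
  output : List ((ℝ × ℝ) × (ℝ × ℝ))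

/-- The initial configuration with the given memory: all registers are `0`, nothing is reported. -/
def Config.init (ints : ℕ → ℕ) (reals : ℕ → ℝ) : Config where
  pc := 0
  intReg := fun _ => 0
  realReg := fun _ => 0
  ints := ints
  reals := reals
  output := []

open Classical in
/-- The effect of one instruction. -/
def Instr.exec (σ : Config) : Instr → Config
  | const d k =>
    { σ with pc := σ.pc + 1, intReg := Function.update σ.intReg d k }
  | addConst d a k =>
    { σ with pc := σ.pc + 1, intReg := Function.update σ.intReg d (σ.intReg a + k) }
  | load d a k =>
    { σ with pc := σ.pc + 1, intReg := Function.update σ.intReg d (σ.ints (σ.intReg a + k)) }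
  | store a k b =>
    { σ with pc := σ.pc + 1, ints := Function.update σ.ints (σ.intReg a + k) (σ.intReg b) }
  | moveReal d a =>
    { σ with pc := σ.pc + 1, realReg := Function.update σ.realReg d (σ.realReg a) }
  | loadReal d a k =>
    { σ with pc := σ.pc + 1, realReg := Function.update σ.realReg d (σ.reals (σ.intReg a + k)) }
  | storeReal a k b =>
    { σ with pc := σ.pc + 1, reals := Function.update σ.reals (σ.intReg a + k) (σ.realReg b) }
  | jump l => { σ with pc := l }
  | jumpEq a b l => { σ with pc := if σ.intReg a = σ.intReg b then l else σ.pc + 1 }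
  | jumpLt a b l => { σ with pc := if σ.intReg a < σ.intReg b then l else σ.pc + 1 }
  | jumpRealEq a b l => { σ with pc := if σ.realReg a = σ.realReg b then l else σ.pc + 1 }
  | jumpRealLt a b l => { σ with pc := if σ.realReg a < σ.realReg b then l else σ.pc + 1 }
  | report a b c d =>
    { σ with
      pc := σ.pc + 1
      output := ((σ.realReg a, σ.realReg b), (σ.realReg c, σ.realReg d)) :: σ.output }

/-- `Steps p t σ τ`: program `p` executes exactly `t` instructions to get from `σ` to `τ`. -/
inductive Steps (p : Program) : ℕ → Config → Config → Prop
  | refl (σ : Config) : Steps p 0 σ σ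
  | step {t : ℕ} {σ τ : Config} {i : Instr} (fetch : p[σ.pc]? = some i)
      (rest : Steps p t (i.exec σ) τ) : Steps p (t + 1) σ τ

/-- From `σ`, program `p` halts in `τ` after exactly `t` steps; it halts when the program counter
points to no instruction. -/
def HaltsAfter (p : Program) (t : ℕ) (σ τ : Config) : Prop :=
  Steps p t σ τ ∧ p[τ.pc]? = none

end RectCover

end

/-! The geometric core is that the base rectangles inside a rectangle `R` of the powerset form a
grid. Crossing parity flips across an edge, so every boundary point is a limit both of enclosed
points and of exterior points. A non-inner point in the open box of `R` would therefore give a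
nonempty open set that no base rectangle meets; so that open box consists of inner points
(`openBox_subset_inner`). A ray that meets it cannot start there, since vertices are not inner, and
hence runs along a whole chord. Thus the sides of the base rectangles in `R` lie on lines that
separate all of them (`isVerticalLine_of_mem`, `isHorizontalLine_of_mem`). Cutting `R` along such
lines stays in the powerset, and neighbors exist in every direction until the border of `R` is
reached.

Each rectangle of the powerset has exactly one base rectangle `B` at its top-left vertex. For fixed
`B` the algorithm walks right along the top row and, in each column, downwards; a visited cell `p`
stands for the rectangle that spans from the top-left vertex of `B` to the bottom-right vertex of
`p`. After the first column, the descent stops also at the lowest bottom `β` that was possible with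
the preceding column, and where the next cell has no left neighbor. `Scan.exists_proceeds` shows
that these tests never stop too early, `Scan.of_proceeds` that they never stop too late.

For the time bound, each visit to a cell reports a new rectangle, and at most a constant number of
steps separates two visits: moving to another column or corner leads at once to another cell,
because every base rectangle belongs to the powerset itself. -/

namespace RectCover

/-! ### Crossing parity near the boundary, and the inner points -/

open Filter Topology

/-! ### Parities -/

open Classical in
/-- The indicator of a proposition, modulo 2. -/
noncomputable def parity (p : Prop) : ZMod 2 := if p then 1 else 0

theorem parity_of_true {p : Prop} (h : p) : parity p = 1 := if_pos h

theorem parity_of_false {p : Prop} (h : ¬ p) : parity p = 0 := if_neg h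

theorem parity_and (p q : Prop) : parity (p ∧ q) = parity p * parity q := by
  by_cases hp : p <;> by_cases hq : q <;> simp [parity, hp, hq]

theorem parity_not_iff (p q : Prop) : parity (¬(p ↔ q)) = parity p + parity q := by
  by_cases hp : p <;> by_cases hq : q <;> simp [parity, hp, hq, CharTwo.add_self_eq_zero]

theorem odd_ncard_iff {ι : Type*} [Fintype ι] (p : ι → Prop) :
    Odd {i | p i}.ncard ↔ ∑ i, parity (p i) = 1 := by
  classical
  rw [← ZMod.natCast_eq_one_iff_odd, Set.ncard_eq_toFinset_card', Set.toFinset_ofPred,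
    Finset.card_filter]
  simp [parity]

/-- The indicator can jump at `b` only if `a = b`, and then only to the left because the inequality
is weak. Writing the jump as a product keeps the later expansion of `crossing` polynomial. -/
theorem parity_le_eventually (a b : ℝ) :
    ∀ᶠ b' in 𝓝 b, parity (a ≤ b') = parity (a ≤ b) + parity (a = b) * parity (b' < b) := by
  rcases lt_trichotomy a b with h | rfl | h
  · filter_upwards [lt_mem_nhds h] with b' h'
    rw [parity_of_true h'.le, parity_of_true h.le, parity_of_false h.ne]; simp
  · filter_upwards with b'
    rw [parity_of_true le_rfl, parity_of_true rfl]
    rcases lt_or_ge b' a with h | h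
    · rw [parity_of_true h, parity_of_false h.not_ge]; simp [CharTwo.add_self_eq_zero]
    · rw [parity_of_false h.not_gt, parity_of_true h]; simp
  · filter_upwards [gt_mem_nhds h] with b' h'
    rw [parity_of_false (not_le.2 h'), parity_of_false h.not_ge, parity_of_false h.ne']; simp

theorem parity_lt_eventually (a b : ℝ) :
    ∀ᶠ b' in 𝓝 b, parity (b' < a) = parity (b < a) + parity (a = b) * parity (b' < b) := by
  rcases lt_trichotomy a b with h | rfl | h
  · filter_upwards [lt_mem_nhds h] with b' h'
    rw [parity_of_false (not_lt.2 h'.le), parity_of_false h.not_gt, parity_of_false h.ne]; simp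
  · filter_upwards with b'
    rw [parity_of_false (lt_irrefl a), parity_of_true rfl]; simp
  · filter_upwards [gt_mem_nhds h] with b' h'
    rw [parity_of_true h', parity_of_true h, parity_of_false h.ne']; simp

/-! ### Edges -/

theorem mem_hEdge {n : ℕ} {x y : Fin n → ℝ} {i : Fin n} {q : ℝ × ℝ} :
    q ∈ hEdge x y i ↔ q.1 ∈ Set.uIcc (x i) (x (finRotate n i)) ∧ q.2 = y i := by
  rw [hEdge, ← Prod.image_mk_segment_left, segment_eq_uIcc]
  constructor
  · rintro ⟨t, ht, rfl⟩; exact ⟨ht, rfl⟩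
  · rintro ⟨h1, h2⟩; exact ⟨q.1, h1, Prod.ext rfl h2.symm⟩

theorem mem_vEdge {n : ℕ} {x y : Fin n → ℝ} {i : Fin n} {q : ℝ × ℝ} :
    q ∈ vEdge x y i ↔ q.1 = x (finRotate n i) ∧ q.2 ∈ Set.uIcc (y i) (y (finRotate n i)) := by
  rw [vEdge, ← Prod.image_mk_segment_right, segment_eq_uIcc]
  constructor
  · rintro ⟨t, ht, rfl⟩; exact ⟨rfl, ht⟩
  · rintro ⟨h1, h2⟩; exact ⟨q.2, h2, Prod.ext h1.symm rfl⟩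

namespace SimplePolygon

variable (c : SimplePolygon)

theorem hEdge_subset_boundary (i : Fin c.n) : hEdge c.x c.y i ⊆ c.boundary :=
  fun _ h => Or.inl (Set.mem_iUnion.2 ⟨i, h⟩)

theorem vEdge_subset_boundary (i : Fin c.n) : vEdge c.x c.y i ⊆ c.boundary :=
  fun _ h => Or.inr (Set.mem_iUnion.2 ⟨i, h⟩)

theorem isClosed_boundary : IsClosed c.boundary := by
  have key : ∀ a b : ℝ × ℝ, IsClosed (segment ℝ a b) := fun a b => by
    rw [segment_eq_image_lineMap]
    exact (isCompact_Icc.image (AffineMap.lineMap_continuous)).isClosed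
  exact (isClosed_iUnion_of_finite fun _ => key _ _).union
    (isClosed_iUnion_of_finite fun _ => key _ _)

theorem vertices_subset_boundary : c.vertices ⊆ c.boundary := by
  rintro v ⟨u, w, i, ⟨-, rfl, -⟩ | ⟨-, rfl, -⟩⟩
  · exact c.hEdge_subset_boundary i (right_mem_segment ℝ _ _)
  · exact c.vEdge_subset_boundary i (right_mem_segment ℝ _ _)

/-! ### The even-odd rule -/

/-- The number of horizontal edges crossed by the upward ray of `q`, modulo 2. -/
noncomputable def crossing (q : ℝ × ℝ) : ZMod 2 :=
  ∑ i, parity (q.2 < c.y i) *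
    (parity (c.x i ≤ q.1) + parity (c.x (finRotate c.n i) ≤ q.1))

/-- The number of ends above `q` of the vertical edges through the abscissa of `q`, modulo 2. -/
noncomputable def verticalEnds (q : ℝ × ℝ) : ZMod 2 :=
  ∑ i, parity (c.x (finRotate c.n i) = q.1) *
    (parity (q.2 < c.y i) + parity (q.2 < c.y (finRotate c.n i)))

theorem mem_inside_iff (q : ℝ × ℝ) : q ∈ c.inside ↔ q ∉ c.boundary ∧ c.crossing q = 1 := by
  simp only [inside, Set.mem_ofPred_eq, odd_ncard_iff, parity_and, parity_not_iff, crossing]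

/-- Each vertex is an end of one horizontal and one vertical edge; reindexing by `finRotate` passes
from one count to the other. -/
theorem verticalEnds_eq (q : ℝ × ℝ) :
    c.verticalEnds q = ∑ i, parity (q.2 < c.y i) *
      (parity (c.x i = q.1) + parity (c.x (finRotate c.n i) = q.1)) := by
  simp only [verticalEnds, mul_add, Finset.sum_add_distrib]
  rw [add_comm]
  congr 1
  · rw [← Equiv.sum_comp (finRotate c.n) fun i => parity (q.2 < c.y i) * parity (c.x i = q.1)]
    exact Finset.sum_congr rfl fun i _ => mul_comm _ _
  · exact Finset.sum_congr rfl fun i _ => mul_comm _ _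

/-- Expand both factors of each summand by their local formulas and multiply out. The `verticalEnds`
term is the change on moving to the left of `q`; the last sum, over the horizontal edges at the
height of `q`, is the change on moving below it. -/
theorem crossing_eventually (q : ℝ × ℝ) :
    ∀ᶠ q' in 𝓝 q, c.crossing q' = c.crossing q + parity (q'.1 < q.1) * c.verticalEnds q +
      ∑ i, parity (c.y i = q.2) * parity (q'.2 < q.2) *
        (parity (c.x i ≤ q.1) + parity (c.x (finRotate c.n i) ≤ q.1) +
          parity (q'.1 < q.1) *
            (parity (c.x i = q.1) + parity (c.x (finRotate c.n i) = q.1))) := by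
  have h1 : ∀ᶠ q' in 𝓝 q, ∀ i, parity (c.x i ≤ q'.1) =
      parity (c.x i ≤ q.1) + parity (c.x i = q.1) * parity (q'.1 < q.1) :=
    eventually_all.2 fun i => continuous_fst.continuousAt.eventually (parity_le_eventually _ _)
  have h2 : ∀ᶠ q' in 𝓝 q, ∀ i, parity (q'.2 < c.y i) =
      parity (q.2 < c.y i) + parity (c.y i = q.2) * parity (q'.2 < q.2) :=
    eventually_all.2 fun i => continuous_snd.continuousAt.eventually (parity_lt_eventually _ _)
  filter_upwards [h1, h2] with q' h1 h2
  rw [verticalEnds_eq, crossing, crossing, Finset.mul_sum, ← Finset.sum_add_distrib,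
    ← Finset.sum_add_distrib]
  refine Finset.sum_congr rfl fun i _ => ?_
  rw [h1, h1, h2]; ring

theorem parity_le_add_of_notMem_uIcc {a b t : ℝ} (h : t ∉ Set.uIcc a b) :
    parity (a ≤ t) + parity (b ≤ t) = 0 ∧ parity (a = t) + parity (b = t) = 0 := by
  have ha : a ≠ t := fun e => h (e ▸ Set.left_mem_uIcc)
  have hb : b ≠ t := fun e => h (e ▸ Set.right_mem_uIcc)
  refine ⟨?_, by rw [parity_of_false ha, parity_of_false hb, add_zero]⟩
  rw [Set.mem_uIcc] at h
  by_cases h1 : a ≤ t <;> by_cases h2 : b ≤ t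
  · rw [parity_of_true h1, parity_of_true h2, CharTwo.add_self_eq_zero]
  · exact (h (Or.inl ⟨h1, (not_le.1 h2).le⟩)).elim
  · exact (h (Or.inr ⟨h2, (not_le.1 h1).le⟩)).elim
  · rw [parity_of_false h1, parity_of_false h2, add_zero]

theorem parity_lt_add_of_notMem_uIcc {a b t : ℝ} (h : t ∉ Set.uIcc a b) :
    parity (t < a) + parity (t < b) = 0 := by
  rw [Set.mem_uIcc] at h
  by_cases h1 : t < a <;> by_cases h2 : t < b
  · rw [parity_of_true h1, parity_of_true h2, CharTwo.add_self_eq_zero]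
  · exact (h (Or.inr ⟨not_lt.1 h2, h1.le⟩)).elim
  · exact (h (Or.inl ⟨not_lt.1 h1, h2.le⟩)).elim
  · rw [parity_of_false h1, parity_of_false h2, add_zero]

/-- Off the boundary, an edge on the vertical or horizontal line of `q` misses `q`, so its two ends
lie on the same side and cancel modulo 2. All correction terms vanish. -/
theorem crossing_eventually_eq {q : ℝ × ℝ} (hq : q ∉ c.boundary) :
    ∀ᶠ q' in 𝓝 q, c.crossing q' = c.crossing q := by
  filter_upwards [c.crossing_eventually q] with q' h
  rw [h, verticalEnds, Finset.sum_eq_zero, Finset.sum_eq_zero, mul_zero, add_zero, add_zero]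
  · intro i _
    by_cases hy : c.y i = q.2
    · obtain ⟨e1, e2⟩ := parity_le_add_of_notMem_uIcc fun hx =>
        hq (c.hEdge_subset_boundary i (mem_hEdge.2 ⟨hx, hy.symm⟩))
      rw [e1, e2, mul_zero, add_zero, mul_zero]
    · rw [parity_of_false hy, zero_mul, zero_mul]
  · intro i _
    by_cases hx : c.x (finRotate c.n i) = q.1
    · rw [parity_lt_add_of_notMem_uIcc fun hy =>
        hq (c.vEdge_subset_boundary i (mem_vEdge.2 ⟨hx.symm, hy⟩)), mul_zero]
    · rw [parity_of_false hx, zero_mul]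

theorem isOpen_inside : IsOpen c.inside := by
  rw [isOpen_iff_mem_nhds]
  intro q hq
  rw [mem_inside_iff] at hq
  filter_upwards [c.crossing_eventually_eq hq.1, c.isClosed_boundary.isOpen_compl.mem_nhds hq.1]
    with q' h1 h2
  exact (c.mem_inside_iff q').2 ⟨h2, h1.trans hq.2⟩

theorem isOpen_outside : IsOpen (c.closedRegion)ᶜ := by
  rw [isOpen_iff_mem_nhds]
  intro q hq
  have hb : q ∉ c.boundary := fun h => hq (Or.inr h)
  filter_upwards [c.crossing_eventually_eq hb, c.isClosed_boundary.isOpen_compl.mem_nhds hb]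
    with q' h1 h2 h3
  rcases h3 with h3 | h3
  · exact hq (Or.inl ((c.mem_inside_iff q).2 ⟨hb, h1 ▸ ((c.mem_inside_iff q').1 h3).2⟩))
  · exact h2 h3

theorem notMem_boundary_of_generic {q : ℝ × ℝ} (hx : q.1 ∉ Set.range c.x)
    (hy : q.2 ∉ Set.range c.y) : q ∉ c.boundary := by
  rintro (h | h) <;> obtain ⟨i, h⟩ := Set.mem_iUnion.1 h
  · exact hy ⟨i, (mem_hEdge.1 h).2.symm⟩
  · exact hx ⟨_, (mem_vEdge.1 h).1.symm⟩

/-- Two points off the boundary of different parity lie on different sides of it. -/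
theorem exists_inside_outside {U : Set (ℝ × ℝ)} {u w : ℝ × ℝ} (hu : u ∈ U) (hw : w ∈ U)
    (hub : u ∉ c.boundary) (hwb : w ∉ c.boundary) (h : c.crossing w = c.crossing u + 1) :
    (∃ a ∈ U, a ∈ c.inside) ∧ ∃ b ∈ U, b ∉ c.closedRegion := by
  by_cases h1 : c.crossing u = 1
  · have h2 : c.crossing w = 0 := by rw [h, h1, CharTwo.add_self_eq_zero]
    refine ⟨⟨u, hu, (c.mem_inside_iff u).2 ⟨hub, h1⟩⟩, w, hw, ?_⟩
    rintro (h3 | h3)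
    · rw [mem_inside_iff, h2] at h3; exact zero_ne_one h3.2
    · exact hwb h3
  · have h2 : c.crossing u = 0 := by
      revert h1; generalize c.crossing u = z; revert z; decide
    refine ⟨⟨w, hw, (c.mem_inside_iff w).2 ⟨hwb, by rw [h, h2, zero_add]⟩⟩, u, hu, ?_⟩
    rintro (h3 | h3)
    · exact h1 ((c.mem_inside_iff u).1 h3).2
    · exact hub h3

theorem exists_generic_between {a b t : ℝ} (hab : a ≠ b) (ht : t ∈ Set.uIcc a b) {W : Set ℝ}
    (hW : IsOpen W) (htW : t ∈ W) {F : Set ℝ} (hF : F.Finite) :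
    ∃ s ∈ W, s ∈ Set.Ioo (min a b) (max a b) ∧ s ∉ F := by
  have hlt : min a b < max a b := min_lt_max.2 hab
  have hne : (W ∩ Set.Ioo (min a b) (max a b)).Nonempty := by
    refine mem_closure_iff.1 ?_ W hW htW
    rwa [closure_Ioo hlt.ne]
  obtain ⟨s, ⟨h1, h2⟩, h3⟩ := (dense_univ.sdiff_finite hF).inter_open_nonempty _
    (hW.inter isOpen_Ioo) hne
  exact ⟨s, h1, h2, h3.2⟩

theorem eventually_right_left_notMem {F : Set ℝ} (hF : F.Finite) (t : ℝ) :
    (∀ᶠ s in 𝓝[>] t, s ∉ F) ∧ ∀ᶠ s in 𝓝[<] t, s ∉ F := by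
  have h : ∀ᶠ s in 𝓝[≠] t, s ∉ F := by
    have h1 : ∀ᶠ s in 𝓝 t, s ∉ F \ {t} :=
      (hF.subset Set.sdiff_subset).isClosed.isOpen_compl.mem_nhds (by simp)
    filter_upwards [h1.filter_mono nhdsWithin_le_nhds, self_mem_nhdsWithin] with s h2 h3 h4
    exact h2 ⟨h4, h3⟩
  exact ⟨h.filter_mono (nhdsWithin_mono _ fun _ => ne_of_gt),
    h.filter_mono (nhdsWithin_mono _ fun _ => ne_of_lt)⟩

theorem parity_le_add_of_mem_Ioo {a b t : ℝ} (h : t ∈ Set.Ioo (min a b) (max a b)) :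
    parity (a ≤ t) + parity (b ≤ t) = 1 := by
  rcases le_total a b with hab | hab
  · rw [min_eq_left hab, max_eq_right hab] at h
    rw [parity_of_true h.1.le, parity_of_false h.2.not_ge, add_zero]
  · rw [min_eq_right hab, max_eq_left hab] at h
    rw [parity_of_true h.1.le, parity_of_false h.2.not_ge, zero_add]

theorem parity_lt_add_of_mem_Ioo {a b t : ℝ} (h : t ∈ Set.Ioo (min a b) (max a b)) :
    parity (t < a) + parity (t < b) = 1 := by
  rcases le_total a b with hab | hab
  · rw [min_eq_left hab, max_eq_right hab] at h
    rw [parity_of_true h.2, parity_of_false h.1.not_gt, zero_add]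
  · rw [min_eq_right hab, max_eq_left hab] at h
    rw [parity_of_true h.2, parity_of_false h.1.not_gt, add_zero]

/-- Move within `U` along the edge to a relative interior point whose abscissa is that of no vertex.
Only edge `i` passes there, by disjointness of the horizontal edges, so the parity differs by one
just above and just below. -/
theorem exists_sides_of_mem_hEdge {i : Fin c.n} {q : ℝ × ℝ} (hq : q ∈ hEdge c.x c.y i)
    {U : Set (ℝ × ℝ)} (hU : IsOpen U) (hqU : q ∈ U) :
    (∃ a ∈ U, a ∈ c.inside) ∧ ∃ b ∈ U, b ∉ c.closedRegion := by
  rw [mem_hEdge] at hq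
  obtain ⟨s, hsU, hs, hsF⟩ := exists_generic_between (c.x_ne i) hq.1
    (hU.preimage (Continuous.prodMk_left q.2)) hqU (Set.finite_range c.x)
  have hx : ∀ j, c.x j ≠ s := fun j e => hsF ⟨j, e⟩
  have hV : c.verticalEnds (s, q.2) = 0 :=
    Finset.sum_eq_zero fun j _ => by rw [parity_of_false (hx _), zero_mul]
  have hsum : ∑ j, parity (c.y j = q.2) *
      (parity (c.x j ≤ s) + parity (c.x (finRotate c.n j) ≤ s)) = 1 := by
    rw [Finset.sum_eq_single i]
    · rw [parity_of_true hq.2.symm, one_mul, parity_le_add_of_mem_Ioo hs]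
    · intro j _ hj
      by_cases hy : c.y j = q.2
      · rw [(parity_le_add_of_notMem_uIcc fun h => ?_).1, mul_zero]
        exact Set.disjoint_left.1 (c.hEdge_disjoint j i hj)
          (mem_hEdge.2 ⟨h, hy.symm⟩ : (s, q.2) ∈ _)
          (mem_hEdge.2 ⟨Set.Ioo_subset_Icc_self hs, hq.2⟩)
      · rw [parity_of_false hy, zero_mul]
    · simp
  have hE : ∀ᶠ t in 𝓝 q.2, (s, t) ∈ U ∧ c.crossing (s, t) = c.crossing (s, q.2) +
      parity (t < q.2) := by
    filter_upwards [(Continuous.prodMk_right s).continuousAt.eventually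
      ((c.crossing_eventually (s, q.2)).and (hU.mem_nhds hsU))] with t ht
    refine ⟨ht.2, ht.1.trans ?_⟩
    rw [hV, mul_zero, add_zero]
    congr 1
    refine Eq.trans ?_ (mul_one _)
    rw [← hsum, Finset.mul_sum]
    refine Finset.sum_congr rfl fun j _ => ?_
    simp only [parity_of_false (lt_irrefl s)]
    ring
  -- One point above and one below the edge, both at ordinates of no vertex, so that they are off
  -- the whole boundary.
  obtain ⟨t, ⟨htU, ht⟩, ht1, ht2⟩ := ((hE.filter_mono nhdsWithin_le_nhds).and
    ((eventually_right_left_notMem (Set.finite_range c.y) q.2).1.and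
      self_mem_nhdsWithin)).exists
  obtain ⟨r, ⟨hrU, hr⟩, hr1, hr2⟩ := ((hE.filter_mono nhdsWithin_le_nhds).and
    ((eventually_right_left_notMem (Set.finite_range c.y) q.2).2.and
      self_mem_nhdsWithin)).exists
  refine c.exists_inside_outside htU hrU (c.notMem_boundary_of_generic hsF ht1)
    (c.notMem_boundary_of_generic hsF hr1) ?_
  rw [hr, ht, parity_of_true hr2, parity_of_false (not_lt.2 (le_of_lt ht2)), add_zero]

/-- Here the jump comes from `verticalEnds`: at a generic height exactly one end of edge `i` lies
above, while every other vertical edge on the same line contributes an even number. -/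
theorem exists_sides_of_mem_vEdge {i : Fin c.n} {q : ℝ × ℝ} (hq : q ∈ vEdge c.x c.y i)
    {U : Set (ℝ × ℝ)} (hU : IsOpen U) (hqU : q ∈ U) :
    (∃ a ∈ U, a ∈ c.inside) ∧ ∃ b ∈ U, b ∉ c.closedRegion := by
  rw [mem_vEdge] at hq
  obtain ⟨s, hsU, hs, hsF⟩ := exists_generic_between (c.y_ne i) hq.2
    (hU.preimage (Continuous.prodMk_right q.1)) hqU (Set.finite_range c.y)
  have hy : ∀ j, c.y j ≠ s := fun j e => hsF ⟨j, e⟩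
  have hV : c.verticalEnds (q.1, s) = 1 := by
    rw [verticalEnds, Finset.sum_eq_single i]
    · rw [parity_of_true hq.1.symm, one_mul, parity_lt_add_of_mem_Ioo hs]
    · intro j _ hj
      by_cases hx : c.x (finRotate c.n j) = q.1
      · rw [parity_lt_add_of_notMem_uIcc fun h => ?_, mul_zero]
        exact Set.disjoint_left.1 (c.vEdge_disjoint j i hj)
          (mem_vEdge.2 ⟨hx.symm, h⟩ : (q.1, s) ∈ _)
          (mem_vEdge.2 ⟨hq.1, Set.Ioo_subset_Icc_self hs⟩)
      · rw [parity_of_false hx, zero_mul]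
    · simp
  have hE : ∀ᶠ t in 𝓝 q.1, (t, s) ∈ U ∧ c.crossing (t, s) = c.crossing (q.1, s) +
      parity (t < q.1) := by
    filter_upwards [(Continuous.prodMk_left s).continuousAt.eventually
      ((c.crossing_eventually (q.1, s)).and (hU.mem_nhds hsU))] with t ht
    refine ⟨ht.2, ht.1.trans ?_⟩
    rw [hV, mul_one, Finset.sum_eq_zero, add_zero]
    intro j _
    rw [parity_of_false (hy j), zero_mul, zero_mul]
  obtain ⟨t, ⟨htU, ht⟩, ht1, ht2⟩ := ((hE.filter_mono nhdsWithin_le_nhds).and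
    ((eventually_right_left_notMem (Set.finite_range c.x) q.1).1.and
      self_mem_nhdsWithin)).exists
  obtain ⟨r, ⟨hrU, hr⟩, hr1, hr2⟩ := ((hE.filter_mono nhdsWithin_le_nhds).and
    ((eventually_right_left_notMem (Set.finite_range c.x) q.1).2.and
      self_mem_nhdsWithin)).exists
  refine c.exists_inside_outside htU hrU (c.notMem_boundary_of_generic ht1 hsF)
    (c.notMem_boundary_of_generic hr1 hsF) ?_
  rw [hr, ht, parity_of_true hr2, parity_of_false (not_lt.2 (le_of_lt ht2)), add_zero]

/-- Every boundary point is a limit of enclosed points and of points of the exterior. -/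
theorem exists_sides_of_mem_boundary {q : ℝ × ℝ} (hq : q ∈ c.boundary)
    {U : Set (ℝ × ℝ)} (hU : IsOpen U) (hqU : q ∈ U) :
    (∃ a ∈ U, a ∈ c.inside) ∧ ∃ b ∈ U, b ∉ c.closedRegion := by
  rcases hq with h | h <;> obtain ⟨i, h⟩ := Set.mem_iUnion.1 h
  · exact c.exists_sides_of_mem_hEdge h hU hqU
  · exact c.exists_sides_of_mem_vEdge h hU hqU

end SimplePolygon

namespace Polygon

variable (P : Polygon)

/-- An open set that is not contained in the inner points has an open part without them. -/
theorem exists_open_disjoint_inner {U : Set (ℝ × ℝ)} (hU : IsOpen U) {q : ℝ × ℝ} (hqU : q ∈ U)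
    (hq : q ∉ P.inner) :
    ∃ V ⊆ U, IsOpen V ∧ V.Nonempty ∧ Disjoint V P.inner := by
  by_cases h1 : q ∈ P.outer.inside
  · obtain ⟨i, hi⟩ : ∃ i, q ∈ (P.hole i).closedRegion := by
      by_contra! h; exact hq ⟨h1, h⟩
    obtain ⟨a, haU, ha⟩ : ∃ a ∈ U, a ∈ (P.hole i).inside := by
      rcases hi with hi | hi
      · exact ⟨q, hqU, hi⟩
      · exact ((P.hole i).exists_sides_of_mem_boundary hi hU hqU).1
    exact ⟨U ∩ (P.hole i).inside, Set.inter_subset_left, hU.inter (P.hole i).isOpen_inside,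
      ⟨a, haU, ha⟩, Set.disjoint_left.2 fun z hz hz' => hz'.2 i (Or.inl hz.2)⟩
  · obtain ⟨b, hbU, hb⟩ : ∃ b ∈ U, b ∉ P.outer.closedRegion := by
      by_cases h2 : q ∈ P.outer.boundary
      · exact (P.outer.exists_sides_of_mem_boundary h2 hU hqU).2
      · exact ⟨q, hqU, fun h => h.elim h1 h2⟩
    exact ⟨U ∩ (P.outer.closedRegion)ᶜ, Set.inter_subset_left, hU.inter P.outer.isOpen_outside,
      ⟨b, hbU, hb⟩, Set.disjoint_left.2 fun z hz hz' => hz.2 (Or.inl hz'.1)⟩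

theorem notMem_inner_of_isConcaveVertex {v : ℝ × ℝ} (hv : P.IsConcaveVertex v) :
    v ∉ P.inner := by
  obtain ⟨c, hc, u, w, h, -⟩ := hv
  have hb : v ∈ c.boundary := c.vertices_subset_boundary ⟨u, w, h⟩
  rcases hc with rfl | ⟨i, rfl⟩
  · exact fun h => h.1.1 hb
  · exact fun h => h.2 i (Or.inr hb)

end Polygon

end RectCover

/-! ### Base rectangles and the grid they form in a rectangle of the powerset -/

namespace RectCover

open Filter Topology

/-! ### Rectangles -/

namespace Rect

/-- `B` is contained in `R`, in coordinates. -/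
def Within (B R : Rect) : Prop :=
  R.left ≤ B.left ∧ B.right ≤ R.right ∧ R.bottom ≤ B.bottom ∧ B.top ≤ R.top

/-- The open boxes of `A` and `B` intersect, in coordinates. -/
def Overlaps (A B : Rect) : Prop :=
  A.left < B.right ∧ B.left < A.right ∧ A.bottom < B.top ∧ B.bottom < A.top

variable (R : Rect)

theorem isOpen_openBox : IsOpen R.openBox := isOpen_Ioo.prod isOpen_Ioo

theorem isClosed_closedBox : IsClosed R.closedBox := isClosed_Icc.prod isClosed_Icc

theorem convex_openBox : Convex ℝ R.openBox := (convex_Ioo _ _).prod (convex_Ioo _ _)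

theorem closure_openBox : closure R.openBox = R.closedBox := by
  rw [openBox, closure_prod_eq, closure_Ioo R.left_lt_right.ne, closure_Ioo R.bottom_lt_top.ne,
    closedBox]

theorem openBox_subset_closedBox : R.openBox ⊆ R.closedBox :=
  R.closure_openBox ▸ subset_closure

/-- The center of a rectangle. -/
noncomputable def center : ℝ × ℝ := ((R.left + R.right) / 2, (R.bottom + R.top) / 2)

theorem center_fst_mem : R.center.1 ∈ Set.Ioo R.left R.right := by
  have := R.left_lt_right
  constructor <;> simp only [center] <;> linarith

theorem center_snd_mem : R.center.2 ∈ Set.Ioo R.bottom R.top := by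
  have := R.bottom_lt_top
  constructor <;> simp only [center] <;> linarith

theorem center_mem : R.center ∈ R.openBox := ⟨R.center_fst_mem, R.center_snd_mem⟩

variable {R} {A B : Rect}

theorem Within.closedBox_subset (h : B.Within R) : B.closedBox ⊆ R.closedBox :=
  Set.prod_mono (Set.Icc_subset_Icc h.1 h.2.1) (Set.Icc_subset_Icc h.2.2.1 h.2.2.2)

theorem Within.openBox_subset (h : B.Within R) : B.openBox ⊆ R.openBox :=
  Set.prod_mono (Set.Ioo_subset_Ioo h.1 h.2.1) (Set.Ioo_subset_Ioo h.2.2.1 h.2.2.2)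

theorem within_of_closedBox_subset (h : B.closedBox ⊆ R.closedBox) : B.Within R := by
  have h1 := h (show (B.left, B.bottom) ∈ B.closedBox from
    ⟨⟨le_rfl, B.left_lt_right.le⟩, le_rfl, B.bottom_lt_top.le⟩)
  have h2 := h (show (B.right, B.top) ∈ B.closedBox from
    ⟨⟨B.left_lt_right.le, le_rfl⟩, B.bottom_lt_top.le, le_rfl⟩)
  exact ⟨h1.1.1, h2.1.2, h1.2.1, h2.2.2⟩

theorem within_antisymm (h : A.Within B) (h' : B.Within A) : A = B := by
  obtain ⟨a1, a2, a3, a4⟩ := h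
  obtain ⟨b1, b2, b3, b4⟩ := h'
  exact Rect.ext (le_antisymm b1 a1) (le_antisymm a4 b4) (le_antisymm a2 b2) (le_antisymm b3 a3)

theorem closedBox_injective : Function.Injective closedBox := fun _ _ h =>
  within_antisymm (within_of_closedBox_subset h.le) (within_of_closedBox_subset h.ge)

theorem openBox_injective : Function.Injective openBox := fun A B h =>
  closedBox_injective (by rw [← A.closure_openBox, h, B.closure_openBox])

theorem Overlaps.nonempty (h : A.Overlaps B) : (A.openBox ∩ B.openBox).Nonempty := by
  obtain ⟨h1, h2, h3, h4⟩ := h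
  obtain ⟨x, hx1, hx2⟩ := exists_between (max_lt (lt_min A.left_lt_right h1)
    (lt_min h2 B.left_lt_right))
  obtain ⟨y, hy1, hy2⟩ := exists_between (max_lt (lt_min A.bottom_lt_top h3)
    (lt_min h4 B.bottom_lt_top))
  rw [max_lt_iff] at hx1 hy1
  rw [lt_min_iff] at hx2 hy2
  exact ⟨(x, y), ⟨⟨hx1.1, hx2.1⟩, hy1.1, hy2.1⟩, ⟨hx1.2, hx2.2⟩, hy1.2, hy2.2⟩

theorem overlaps_of_mem {z : ℝ × ℝ} (hA : z ∈ A.openBox) (hB : z ∈ B.openBox) : A.Overlaps B :=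
  ⟨hA.1.1.trans hB.1.2, hB.1.1.trans hA.1.2, hA.2.1.trans hB.2.2, hB.2.1.trans hA.2.2⟩

/-- An open set that meets the closed box meets the open box. -/
theorem exists_mem_openBox {U : Set (ℝ × ℝ)} (hU : IsOpen U) {z : ℝ × ℝ} (hz : z ∈ U)
    (hzR : z ∈ R.closedBox) : ∃ w ∈ U, w ∈ R.openBox := by
  rw [← R.closure_openBox] at hzR
  exact mem_closure_iff.1 hzR U hU hz

end Rect

/-! ### Base rectangles -/

namespace Polygon

variable {P : Polygon} {R A B : Rect}

theorem openBox_subset_of_mem_baseRectangles (hB : B ∈ P.baseRectangles) :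
    B.openBox ⊆ P.inner \ P.cuts := by
  obtain ⟨q, -, h⟩ := hB
  exact h ▸ connectedComponentIn_subset _ _

theorem subset_openBox_of_mem_baseRectangles (hB : B ∈ P.baseRectangles) {T : Set (ℝ × ℝ)}
    (hT : IsPreconnected T) (hTs : T ⊆ P.inner \ P.cuts) (h : (T ∩ B.openBox).Nonempty) :
    T ⊆ B.openBox := by
  obtain ⟨z, hzT, hzB⟩ := h
  obtain ⟨q, -, hq⟩ := hB
  rw [← hq] at hzB ⊢
  rw [connectedComponentIn_eq hzB]
  exact hT.subset_connectedComponentIn hzT hTs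

theorem baseRectangles_eq_of_overlaps (hA : A ∈ P.baseRectangles) (hB : B ∈ P.baseRectangles)
    (h : A.Overlaps B) : A = B := by
  have key : ∀ {A B : Rect}, A ∈ P.baseRectangles → B ∈ P.baseRectangles →
      (A.openBox ∩ B.openBox).Nonempty → A.openBox ⊆ B.openBox := fun hA hB h =>
    subset_openBox_of_mem_baseRectangles hB
      (Rect.convex_openBox _).isPreconnected (openBox_subset_of_mem_baseRectangles hA) h
  exact Rect.openBox_injective ((key hA hB h.nonempty).antisymm
    (key hB hA (Set.inter_comm _ _ ▸ h.nonempty)))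

/-- The cover is by closed boxes, but an open set that meets a closed box also meets its interior.
-/
theorem exists_overlaps_of_open (hR : R ∈ powerset P.baseRectangles) {V : Set (ℝ × ℝ)}
    (hV : IsOpen V) (hVne : V.Nonempty) (hVR : V ⊆ R.closedBox) :
    ∃ B ∈ P.baseRectangles, B.Within R ∧ (V ∩ B.openBox).Nonempty := by
  obtain ⟨S, hS, hRS⟩ := hR
  obtain ⟨z, hz⟩ := hVne
  have h := hVR hz
  rw [hRS] at h
  obtain ⟨B, hB, hzB⟩ := Set.mem_iUnion₂.1 h
  obtain ⟨w, hwV, hwB⟩ := Rect.exists_mem_openBox hV hz hzB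
  refine ⟨B, hS hB, Rect.within_of_closedBox_subset ?_, w, hwV, hwB⟩
  rw [hRS]
  exact Set.subset_biUnion_of_mem (u := fun B : Rect => B.closedBox) hB

/-- The overlap is open, so it meets the interior of some base rectangle used in covering `R`; since
distinct base rectangles have disjoint interiors, this one is `B`. -/
theorem within_of_overlaps (hR : R ∈ powerset P.baseRectangles) (hB : B ∈ P.baseRectangles)
    (h : B.Overlaps R) : B.Within R := by
  obtain ⟨A, hA, hAR, w, hw, hwA⟩ := exists_overlaps_of_open hR
    (B.isOpen_openBox.inter R.isOpen_openBox) h.nonempty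
    (Set.inter_subset_right.trans R.openBox_subset_closedBox)
  rwa [baseRectangles_eq_of_overlaps hB hA (Rect.overlaps_of_mem hw.1 hwA)]

theorem mem_powerset_iff : R ∈ powerset P.baseRectangles ↔
    ∀ z ∈ R.closedBox, ∃ B ∈ P.baseRectangles, B.Within R ∧ z ∈ B.closedBox := by
  constructor
  · rintro ⟨S, hS, hRS⟩ z hz
    rw [hRS] at hz
    obtain ⟨B, hB, hzB⟩ := Set.mem_iUnion₂.1 hz
    refine ⟨B, hS hB, Rect.within_of_closedBox_subset ?_, hzB⟩
    rw [hRS]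
    exact Set.subset_biUnion_of_mem (u := fun B : Rect => B.closedBox) hB
  · intro h
    refine ⟨{B | B ∈ P.baseRectangles ∧ B.Within R}, fun B hB => hB.1, ?_⟩
    refine Set.Subset.antisymm (fun z hz => ?_) (Set.iUnion₂_subset fun B hB =>
      hB.2.closedBox_subset)
    obtain ⟨B, hB, hBR, hzB⟩ := h z hz
    exact Set.mem_iUnion₂.2 ⟨B, ⟨hB, hBR⟩, hzB⟩

theorem mem_powerset_of_mem (hB : B ∈ P.baseRectangles) : B ∈ powerset P.baseRectangles :=
  mem_powerset_iff.2 fun _ hz => ⟨B, hB, ⟨le_rfl, le_rfl, le_rfl, le_rfl⟩, hz⟩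

theorem finite_powerset (hfin : P.baseRectangles.Finite) :
    (powerset P.baseRectangles).Finite := by
  refine Set.Finite.of_finite_image (f := Rect.closedBox)
    ((hfin.finite_subsets.image fun S => ⋃ B ∈ S, B.closedBox).subset ?_)
    Rect.closedBox_injective.injOn
  rintro _ ⟨R, ⟨S, hS, h⟩, rfl⟩
  exact ⟨S, hS, h.symm⟩

/-- A rectangle that is a union of base rectangles contains no edge in its interior. -/
theorem openBox_subset_inner (hR : R ∈ powerset P.baseRectangles) : R.openBox ⊆ P.inner := by
  intro q hq
  by_contra hqi
  obtain ⟨V, hVR, hV, hVne, hdis⟩ := P.exists_open_disjoint_inner R.isOpen_openBox hq hqi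
  obtain ⟨B, hB, -, w, hwV, hwB⟩ := exists_overlaps_of_open hR hV hVne
    (hVR.trans R.openBox_subset_closedBox)
  exact Set.disjoint_left.1 hdis hwV (openBox_subset_of_mem_baseRectangles hB hwB).1

/-! ### The grid in a rectangle of the powerset -/

/-- A ray that meets the interior of the rectangle contains the whole chord of its line. -/
theorem mem_cuts_of_line (hR : R.openBox ⊆ P.inner) {v d : ℝ × ℝ} (hv : P.IsConcaveVertex v)
    (hd : d ∈ ({(1, 0), (-1, 0), (0, 1), (0, -1)} : Set (ℝ × ℝ)))
    {t : ℝ} (ht0 : 0 < t)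
    (hray : ∀ s ∈ Set.Ioc (0 : ℝ) t, v + s • d ∈ P.inner) (hqR : v + t • d ∈ R.openBox)
    {t' : ℝ} (hz : v + t' • d ∈ R.openBox) : v + t' • d ∈ P.cuts := by
  have hline : ∀ s, (t' ≤ s ∧ s ≤ t ∨ t ≤ s ∧ s ≤ t') → v + s • d ∈ R.openBox := by
    intro s hs
    have hs' : s ∈ segment ℝ t' t := by
      rw [segment_eq_uIcc, Set.mem_uIcc]; exact hs
    obtain ⟨a, b, ha, hb, hab, rfl⟩ := hs'
    have := R.convex_openBox hz hqR ha hb hab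
    convert this using 1
    ext
    · simp only [Prod.fst_add, Prod.smul_fst, smul_eq_mul]
      linear_combination (-v.1) * hab
    · simp only [Prod.snd_add, Prod.smul_snd, smul_eq_mul]
      linear_combination (-v.2) * hab
  -- Otherwise the starting vertex itself lies on the part of the line inside `R`, although it is
  -- not an inner point.
  have ht' : 0 < t' := by
    by_contra! h
    refine P.notMem_inner_of_isConcaveVertex hv (hR ?_)
    simpa using hline 0 (Or.inl ⟨h, ht0.le⟩)
  refine ⟨v, hv, d, hd, t', ht', rfl, fun s hs => ?_⟩
  rcases le_total s t with h | h
  · exact hray s ⟨hs.1, h⟩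
  · exact hR (hline s (Or.inr ⟨h, hs.2⟩))

theorem line_subset_cuts (hR : R.openBox ⊆ P.inner) {q : ℝ × ℝ} (hq : q ∈ P.cuts)
    (hqR : q ∈ R.openBox) :
    (∀ x ∈ Set.Ioo R.left R.right, (x, q.2) ∈ P.cuts) ∨
      ∀ y ∈ Set.Ioo R.bottom R.top, (q.1, y) ∈ P.cuts := by
  obtain ⟨v, hv, d, hd, t, ht, rfl, hray⟩ := hq
  have key := fun t' => mem_cuts_of_line (t' := t') hR hv hd ht hray hqR
  rcases hd with rfl | rfl | rfl | rfl
  · refine Or.inl fun x hx => ?_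
    have e : (x, (v + t • ((1 : ℝ), (0 : ℝ))).2) = v + (x - v.1) • ((1 : ℝ), (0 : ℝ)) := by
      ext <;> simp
    rw [e]; exact key _ (e ▸ ⟨hx, hqR.2⟩)
  · refine Or.inl fun x hx => ?_
    have e : (x, (v + t • (-(1 : ℝ), (0 : ℝ))).2) = v + (v.1 - x) • (-(1 : ℝ), (0 : ℝ)) := by
      ext <;> simp
    rw [e]; exact key _ (e ▸ ⟨hx, hqR.2⟩)
  · refine Or.inr fun y hy => ?_
    have e : ((v + t • ((0 : ℝ), (1 : ℝ))).1, y) = v + (y - v.2) • ((0 : ℝ), (1 : ℝ)) := by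
      ext <;> simp
    rw [e]; exact key _ (e ▸ ⟨hqR.1, hy⟩)
  · refine Or.inr fun y hy => ?_
    have e : ((v + t • ((0 : ℝ), -(1 : ℝ))).1, y) = v + (v.2 - y) • ((0 : ℝ), -(1 : ℝ)) := by
      ext <;> simp
    rw [e]; exact key _ (e ▸ ⟨hqR.1, hy⟩)

/-- Within the inner points, a base rectangle is bounded by cuts. -/
theorem mem_cuts_of_mem_closedBox (hB : B ∈ P.baseRectangles) {z : ℝ × ℝ} (hz : z ∈ P.inner)
    (hzB : z ∈ B.closedBox) (hzB' : z ∉ B.openBox) : z ∈ P.cuts := by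
  by_contra hzc
  -- Adding a point of the closure keeps the box connected; off the cuts this would enlarge a
  -- connected component.
  refine hzB' (subset_openBox_of_mem_baseRectangles hB (T := insert z B.openBox) ?_ ?_ ?_
    (Set.mem_insert _ _))
  · refine B.convex_openBox.isPreconnected.subset_closure (Set.subset_insert _ _) ?_
    rw [B.closure_openBox]
    exact Set.insert_subset hzB B.openBox_subset_closedBox
  · exact Set.insert_subset ⟨hz, hzc⟩ (openBox_subset_of_mem_baseRectangles hB)
  · exact ⟨_, Set.mem_insert_of_mem _ B.center_mem, B.center_mem⟩

/-- The vertical line at `x` separates the base rectangles in `R`. -/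
def IsVerticalLine (P : Polygon) (R : Rect) (x : ℝ) : Prop :=
  ∀ A ∈ P.baseRectangles, A.Within R → ¬(A.left < x ∧ x < A.right)

/-- The horizontal line at `y` separates the base rectangles in `R`. -/
def IsHorizontalLine (P : Polygon) (R : Rect) (y : ℝ) : Prop :=
  ∀ A ∈ P.baseRectangles, A.Within R → ¬(A.bottom < y ∧ y < A.top)

theorem isVerticalLine_left : IsVerticalLine P R R.left := fun _ _ h h' => h'.1.not_ge h.1

theorem isVerticalLine_right : IsVerticalLine P R R.right := fun _ _ h h' => h'.2.not_ge h.2.1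

theorem isHorizontalLine_bottom : IsHorizontalLine P R R.bottom :=
  fun _ _ h h' => h'.1.not_ge h.2.2.1

theorem isHorizontalLine_top : IsHorizontalLine P R R.top := fun _ _ h h' => h'.2.not_ge h.2.2.2

/-- The midpoint of a side of `B` interior to `R` lies on a cut, and that cut extends along a whole
chord of `R`. -/
theorem isVerticalLine_of_mem (hR : R ∈ powerset P.baseRectangles) (hB : B ∈ P.baseRectangles)
    (hBR : B.Within R) {x : ℝ} (hx : x = B.left ∨ x = B.right) : IsVerticalLine P R x := by
  rintro A hA hAR ⟨h1, h2⟩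
  have hxR : x ∈ Set.Ioo R.left R.right := ⟨hAR.1.trans_lt h1, h2.trans_le hAR.2.1⟩
  have hRi := openBox_subset_inner hR
  have hy := B.center_snd_mem
  have hyR : B.center.2 ∈ Set.Ioo R.bottom R.top :=
    ⟨hBR.2.2.1.trans_lt hy.1, hy.2.trans_le hBR.2.2.2⟩
  have hB0 := B.left_lt_right
  have hz : (x, B.center.2) ∈ P.cuts := by
    refine mem_cuts_of_mem_closedBox hB (hRi ⟨hxR, hyR⟩) ⟨?_, hy.1.le, hy.2.le⟩ fun h => ?_
    · rcases hx with rfl | rfl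
      · exact ⟨le_rfl, hB0.le⟩
      · exact ⟨hB0.le, le_rfl⟩
    · rcases hx with rfl | rfl
      · exact lt_irrefl _ h.1.1
      · exact lt_irrefl _ h.1.2
  -- A horizontal chord would pass through the center of `B`, a vertical one through the interior of
  -- `A`.
  rcases line_subset_cuts hRi hz ⟨hxR, hyR⟩ with h | h
  · exact (openBox_subset_of_mem_baseRectangles hB B.center_mem).2
      (h B.center.1 (hBR.openBox_subset B.center_mem).1)
  · exact (openBox_subset_of_mem_baseRectangles hA
      (show (x, A.center.2) ∈ _ from ⟨⟨h1, h2⟩, A.center_snd_mem⟩)).2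
      (h A.center.2 (hAR.openBox_subset A.center_mem).2)

theorem isHorizontalLine_of_mem (hR : R ∈ powerset P.baseRectangles) (hB : B ∈ P.baseRectangles)
    (hBR : B.Within R) {y : ℝ} (hy : y = B.bottom ∨ y = B.top) : IsHorizontalLine P R y := by
  rintro A hA hAR ⟨h1, h2⟩
  have hyR : y ∈ Set.Ioo R.bottom R.top := ⟨hAR.2.2.1.trans_lt h1, h2.trans_le hAR.2.2.2⟩
  have hRi := openBox_subset_inner hR
  have hx := B.center_fst_mem
  have hxR : B.center.1 ∈ Set.Ioo R.left R.right :=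
    ⟨hBR.1.trans_lt hx.1, hx.2.trans_le hBR.2.1⟩
  have hB0 := B.bottom_lt_top
  have hz : (B.center.1, y) ∈ P.cuts := by
    refine mem_cuts_of_mem_closedBox hB (hRi ⟨hxR, hyR⟩) ⟨⟨hx.1.le, hx.2.le⟩, ?_⟩ fun h => ?_
    · rcases hy with rfl | rfl
      · exact ⟨le_rfl, hB0.le⟩
      · exact ⟨hB0.le, le_rfl⟩
    · rcases hy with rfl | rfl
      · exact lt_irrefl _ h.2.1
      · exact lt_irrefl _ h.2.2
  rcases line_subset_cuts hRi hz ⟨hxR, hyR⟩ with h | h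
  · exact (openBox_subset_of_mem_baseRectangles hA
      (show (A.center.1, y) ∈ _ from ⟨A.center_fst_mem, h1, h2⟩)).2
      (h A.center.1 (hAR.openBox_subset A.center_mem).1)
  · exact (openBox_subset_of_mem_baseRectangles hB B.center_mem).2
      (h B.center.2 (hBR.openBox_subset B.center_mem).2)

/-- Cutting a rectangle of the powerset along lines of its grid yields another one. -/
theorem mem_powerset_of_within (hfin : P.baseRectangles.Finite)
    (hR : R ∈ powerset P.baseRectangles) (hA : A.Within R)
    (hl : IsVerticalLine P R A.left) (hr : IsVerticalLine P R A.right)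
    (hb : IsHorizontalLine P R A.bottom) (ht : IsHorizontalLine P R A.top) :
    A ∈ powerset P.baseRectangles := by
  have hcl : IsClosed (⋃ B ∈ {B | B ∈ P.baseRectangles ∧ B.Within A}, B.closedBox) :=
    (hfin.subset fun _ h => h.1).isClosed_biUnion fun B _ => B.isClosed_closedBox
  have hsub : A.openBox ⊆ ⋃ B ∈ {B | B ∈ P.baseRectangles ∧ B.Within A}, B.closedBox := by
    intro z hz
    obtain ⟨B, hB, hBR, hzB⟩ := mem_powerset_iff.1 hR z
      (R.openBox_subset_closedBox (hA.openBox_subset hz))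
    obtain ⟨w, hwA, hwB⟩ := Rect.exists_mem_openBox A.isOpen_openBox hz hzB
    obtain ⟨h1, h2, h3, h4⟩ := Rect.overlaps_of_mem hwA hwB
    refine Set.mem_iUnion₂.2 ⟨B, ⟨hB, ?_, ?_, ?_, ?_⟩, hzB⟩
    · exact not_lt.1 fun h => hl B hB hBR ⟨h, h1⟩
    · exact not_lt.1 fun h => hr B hB hBR ⟨h2, h⟩
    · exact not_lt.1 fun h => hb B hB hBR ⟨h, h3⟩
    · exact not_lt.1 fun h => ht B hB hBR ⟨h4, h⟩
  -- The union is finite, hence closed, so covering the open box suffices. This also deals with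
  -- border points of `A` that are first covered by base rectangles outside `A`.
  have := closure_minimal hsub hcl
  rw [A.closure_openBox] at this
  refine mem_powerset_iff.2 fun z hz => ?_
  obtain ⟨B, hB, hzB⟩ := Set.mem_iUnion₂.1 (this hz)
  exact ⟨B, hB.1, hB.2, hzB⟩

/-- This is the column structure: no vertical side of one of the two rectangles can fall strictly
inside the horizontal extent of the other. -/
theorem left_eq_right_eq_of_lt (hR : R ∈ powerset P.baseRectangles) (hA : A ∈ P.baseRectangles)
    (hAR : A.Within R) (hB : B ∈ P.baseRectangles) (hBR : B.Within R)
    (h1 : A.left < B.right) (h2 : B.left < A.right) : A.left = B.left ∧ A.right = B.right := by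
  have key := fun (x : ℝ) hx => isVerticalLine_of_mem hR hA hAR (x := x) hx B hB hBR
  have key' := fun (x : ℝ) hx => isVerticalLine_of_mem hR hB hBR (x := x) hx A hA hAR
  constructor <;> apply le_antisymm <;> by_contra! h
  · exact key _ (Or.inl rfl) ⟨h, h1⟩
  · exact key' _ (Or.inl rfl) ⟨h, h2⟩
  · exact key' _ (Or.inr rfl) ⟨h1, h⟩
  · exact key _ (Or.inr rfl) ⟨h2, h⟩

theorem bottom_eq_top_eq_of_lt (hR : R ∈ powerset P.baseRectangles) (hA : A ∈ P.baseRectangles)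
    (hAR : A.Within R) (hB : B ∈ P.baseRectangles) (hBR : B.Within R)
    (h1 : A.bottom < B.top) (h2 : B.bottom < A.top) : A.bottom = B.bottom ∧ A.top = B.top := by
  have key := fun (x : ℝ) hx => isHorizontalLine_of_mem hR hA hAR (y := x) hx B hB hBR
  have key' := fun (x : ℝ) hx => isHorizontalLine_of_mem hR hB hBR (y := x) hx A hA hAR
  constructor <;> apply le_antisymm <;> by_contra! h
  · exact key _ (Or.inl rfl) ⟨h, h1⟩
  · exact key' _ (Or.inl rfl) ⟨h, h2⟩
  · exact key' _ (Or.inr rfl) ⟨h1, h⟩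
  · exact key _ (Or.inr rfl) ⟨h2, h⟩

/-- The part `A` of `R` below `B` is again in the powerset. The base rectangle of `A` that covers
the midpoint of the lower side of `B` touches that side from below and lies in the same column. -/
theorem exists_bottom_neighbor (hfin : P.baseRectangles.Finite)
    (hR : R ∈ powerset P.baseRectangles) (hB : B ∈ P.baseRectangles) (hBR : B.Within R)
    (h : R.bottom < B.bottom) :
    ∃ B' ∈ P.baseRectangles, B'.Within R ∧ B.SharesEdge .bottom B' := by
  have hw := hBR
  obtain ⟨h1, h2, h3, h4⟩ := hBR
  have hlt := B.bottom_lt_top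
  have hc := B.center_fst_mem
  let A : Rect := ⟨R.left, B.bottom, R.right, R.bottom, R.left_lt_right, h⟩
  have hAR : A.Within R := ⟨le_rfl, le_rfl, le_rfl, by simp only [A]; linarith⟩
  have hA : A ∈ powerset P.baseRectangles := mem_powerset_of_within hfin hR hAR
    isVerticalLine_left isVerticalLine_right isHorizontalLine_bottom
    (isHorizontalLine_of_mem hR hB hw (Or.inl rfl))
  obtain ⟨B', hB', hBA, hz⟩ := mem_powerset_iff.1 hA (B.center.1, B.bottom)
    ⟨⟨by simp only [A]; linarith [hc.1], by simp only [A]; linarith [hc.2]⟩, h.le, le_rfl⟩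
  have hBR' : B'.Within R :=
    ⟨hBA.1.trans' hAR.1, hBA.2.1.trans hAR.2.1, hBA.2.2.1.trans' hAR.2.2.1,
      hBA.2.2.2.trans hAR.2.2.2⟩
  obtain ⟨e1, e2⟩ := left_eq_right_eq_of_lt hR hB' hBR' hB hw (hz.1.1.trans_lt hc.2)
    (hc.1.trans_le hz.1.2)
  exact ⟨B', hB', hBR', le_antisymm hBA.2.2.2 hz.2.2, e1, e2⟩

theorem exists_right_neighbor (hfin : P.baseRectangles.Finite)
    (hR : R ∈ powerset P.baseRectangles) (hB : B ∈ P.baseRectangles) (hBR : B.Within R)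
    (h : B.right < R.right) :
    ∃ B' ∈ P.baseRectangles, B'.Within R ∧ B.SharesEdge .right B' := by
  have hw := hBR
  obtain ⟨h1, h2, h3, h4⟩ := hBR
  have hlt := B.left_lt_right
  have hc := B.center_snd_mem
  let A : Rect := ⟨B.right, R.top, R.right, R.bottom, h, R.bottom_lt_top⟩
  have hAR : A.Within R := ⟨by simp only [A]; linarith, le_rfl, le_rfl, le_rfl⟩
  have hA : A ∈ powerset P.baseRectangles := mem_powerset_of_within hfin hR hAR
    (isVerticalLine_of_mem hR hB hw (Or.inr rfl)) isVerticalLine_right isHorizontalLine_bottom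
    isHorizontalLine_top
  obtain ⟨B', hB', hBA, hz⟩ := mem_powerset_iff.1 hA (B.right, B.center.2)
    ⟨⟨le_rfl, h.le⟩, by simp only [A]; linarith [hc.1], by simp only [A]; linarith [hc.2]⟩
  have hBR' : B'.Within R :=
    ⟨hBA.1.trans' hAR.1, hBA.2.1.trans hAR.2.1, hBA.2.2.1.trans' hAR.2.2.1,
      hBA.2.2.2.trans hAR.2.2.2⟩
  obtain ⟨e1, e2⟩ := bottom_eq_top_eq_of_lt hR hB' hBR' hB hw (hz.2.1.trans_lt hc.2)
    (hc.1.trans_le hz.2.2)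
  exact ⟨B', hB', hBR', le_antisymm hz.1.1 hBA.1, e1, e2⟩

theorem exists_left_neighbor (hfin : P.baseRectangles.Finite)
    (hR : R ∈ powerset P.baseRectangles) (hB : B ∈ P.baseRectangles) (hBR : B.Within R)
    (h : R.left < B.left) :
    ∃ B' ∈ P.baseRectangles, B'.Within R ∧ B.SharesEdge .left B' := by
  have hw := hBR
  obtain ⟨h1, h2, h3, h4⟩ := hBR
  have hlt := B.left_lt_right
  have hc := B.center_snd_mem
  let A : Rect := ⟨R.left, R.top, B.left, R.bottom, h, R.bottom_lt_top⟩
  have hAR : A.Within R := ⟨le_rfl, by simp only [A]; linarith, le_rfl, le_rfl⟩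
  have hA : A ∈ powerset P.baseRectangles := mem_powerset_of_within hfin hR hAR
    isVerticalLine_left (isVerticalLine_of_mem hR hB hw (Or.inl rfl)) isHorizontalLine_bottom
    isHorizontalLine_top
  obtain ⟨B', hB', hBA, hz⟩ := mem_powerset_iff.1 hA (B.left, B.center.2)
    ⟨⟨h.le, le_rfl⟩, by simp only [A]; linarith [hc.1], by simp only [A]; linarith [hc.2]⟩
  have hBR' : B'.Within R :=
    ⟨hBA.1.trans' hAR.1, hBA.2.1.trans hAR.2.1, hBA.2.2.1.trans' hAR.2.2.1,
      hBA.2.2.2.trans hAR.2.2.2⟩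
  obtain ⟨e1, e2⟩ := bottom_eq_top_eq_of_lt hR hB' hBR' hB hw (hz.2.1.trans_lt hc.2)
    (hc.1.trans_le hz.2.2)
  exact ⟨B', hB', hBR', le_antisymm hBA.2.1 hz.1.2, e1, e2⟩

theorem exists_corner (hR : R ∈ powerset P.baseRectangles) :
    ∃ B ∈ P.baseRectangles, B.Within R ∧ B.left = R.left ∧ B.top = R.top := by
  obtain ⟨B, hB, hBR, hz⟩ := mem_powerset_iff.1 hR (R.left, R.top)
    ⟨⟨le_rfl, R.left_lt_right.le⟩, R.bottom_lt_top.le, le_rfl⟩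
  exact ⟨B, hB, hBR, le_antisymm hz.1.1 hBR.1, le_antisymm hBR.2.2.2 hz.2.2⟩

end Polygon

end RectCover

/-! ### Scanning the columns below and to the right of one corner -/

namespace RectCover

namespace Polygon

variable {P : Polygon} {A B R a a' p p' : Rect} {l t r b β : ℝ}

/-! ### Rectangles with a given top-left vertex -/

theorem mem_powerset_of_cover
    (h : ∀ z ∈ R.closedBox, ∃ A ∈ powerset P.baseRectangles, A.Within R ∧ z ∈ A.closedBox) :
    R ∈ powerset P.baseRectangles := by
  refine mem_powerset_iff.2 fun z hz => ?_
  obtain ⟨A, hA, hAR, hzA⟩ := h z hz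
  obtain ⟨B, hB, hBA, hzB⟩ := mem_powerset_iff.1 hA z hzA
  exact ⟨B, hB, Rect.within_of_closedBox_subset
    (hBA.closedBox_subset.trans hAR.closedBox_subset), hzB⟩

/-- The rectangle with the given left, top, right and bottom coordinates is in the powerset of the
base rectangles. -/
def HasRect (P : Polygon) (l t r b : ℝ) : Prop :=
  ∃ R ∈ powerset P.baseRectangles, R.left = l ∧ R.top = t ∧ R.right = r ∧ R.bottom = b

theorem hasRect_of_mem (hR : R ∈ powerset P.baseRectangles) :
    HasRect P R.left R.top R.right R.bottom := ⟨R, hR, rfl, rfl, rfl, rfl⟩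

theorem HasRect.within (h : HasRect P l t r b) (hA : A ∈ P.baseRectangles) (h1 : A.left < r)
    (h2 : l < A.right) (h3 : A.bottom < t) (h4 : b < A.top) :
    l ≤ A.left ∧ A.right ≤ r ∧ b ≤ A.bottom ∧ A.top ≤ t := by
  obtain ⟨R, hR, rfl, rfl, rfl, rfl⟩ := h
  exact within_of_overlaps hR hA ⟨h1, h2, h3, h4⟩

theorem sharesEdge_unique {s : Side} {A' : Rect} (hA : A ∈ P.baseRectangles)
    (hA' : A' ∈ P.baseRectangles) (h : B.SharesEdge s A) (h' : B.SharesEdge s A') : A = A' := by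
  refine baseRectangles_eq_of_overlaps hA hA' ?_
  have h1 := A.left_lt_right
  have h2 := A.bottom_lt_top
  have h3 := A'.left_lt_right
  have h4 := A'.bottom_lt_top
  cases s <;> obtain ⟨e1, e2, e3⟩ := h <;> obtain ⟨f1, f2, f3⟩ := h' <;>
    refine ⟨?_, ?_, ?_, ?_⟩ <;> linarith

theorem eq_of_corner_eq (hA : A ∈ P.baseRectangles) (hB : B ∈ P.baseRectangles)
    (hl : A.left = B.left) (ht : A.top = B.top) : A = B := by
  refine baseRectangles_eq_of_overlaps hA hB ⟨?_, ?_, ?_, ?_⟩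
  · exact hl ▸ B.left_lt_right
  · exact hl ▸ A.left_lt_right
  · exact ht ▸ A.bottom_lt_top
  · exact ht ▸ B.bottom_lt_top

/-- The state of the enumeration of the rectangles with the top-left vertex of `B`: the column
below `a` is being scanned and `p` has been reached. Unless this is the first column, `β` is the
bottom of the highest rectangle that ends with the preceding column. -/
structure Scan (P : Polygon) (B a p : Rect) (β : ℝ) : Prop where
  mem_corner : B ∈ P.baseRectangles
  mem_column : a ∈ P.baseRectangles
  mem_cell : p ∈ P.baseRectangles
  top_eq : a.top = B.top
  left_eq : p.left = a.left
  right_eq : p.right = a.right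
  hasRect_column : HasRect P B.left B.top a.right a.bottom
  hasRect_cell : HasRect P B.left B.top p.right p.bottom
  previous : a = B ∨ B.left < a.left ∧ HasRect P B.left B.top a.left β ∧
    ∀ b, HasRect P B.left B.top a.left b → β ≤ b

/-- The scan of the column proceeds from `p` to `p'`. -/
def Proceeds (P : Polygon) (B a p p' : Rect) (β : ℝ) : Prop :=
  p' ∈ P.baseRectangles ∧ p.SharesEdge .bottom p' ∧
    (a = B ∨ p.bottom ≠ β ∧ ∃ q ∈ P.baseRectangles, p'.SharesEdge .left q)

namespace Scan

theorem init (hB : B ∈ P.baseRectangles) : Scan P B B B β :=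
  ⟨hB, hB, hB, rfl, rfl, rfl, hasRect_of_mem (mem_powerset_of_mem hB),
    hasRect_of_mem (mem_powerset_of_mem hB), Or.inl rfl⟩

theorem left_le (h : Scan P B a p β) : B.left ≤ a.left := by
  rcases h.previous with h | h
  · rw [h]
  · exact h.1.le

theorem top_le (h : Scan P B a p β) : p.top ≤ B.top := by
  obtain ⟨R, hR, e1, e2, e3, e4⟩ := h.hasRect_cell
  have h1 := R.left_lt_right
  have h2 := R.bottom_lt_top
  have h3 := p.left_lt_right
  have h4 := p.bottom_lt_top
  exact (h.hasRect_cell.within h.mem_cell h3 (by linarith) (by linarith) h4).2.2.2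

/-- A rectangle that reaches the column of the scan can be cut in front of that column. -/
theorem hasRect_left (h : Scan P B a p β) (hfin : P.baseRectangles.Finite)
    (hb : HasRect P B.left B.top r b) (hr : a.left < r) (hlt : B.left < a.left) :
    HasRect P B.left B.top a.left b := by
  obtain ⟨R, hR, e1, e2, e3, rfl⟩ := hb
  have h1 := R.bottom_lt_top
  have h2 := a.left_lt_right
  have h3 := a.bottom_lt_top
  have ht := h.top_eq
  have haR : a.Within R := within_of_overlaps hR h.mem_column
    ⟨by linarith, by linarith, by linarith, by linarith⟩
  refine ⟨⟨R.left, R.top, a.left, R.bottom, e1 ▸ hlt, h1⟩, ?_, e1, e2, rfl, rfl⟩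
  exact mem_powerset_of_within hfin hR ⟨le_rfl, e3 ▸ hr.le, le_rfl, le_rfl⟩ isVerticalLine_left
    (isVerticalLine_of_mem hR h.mem_column haR (Or.inl rfl)) isHorizontalLine_bottom
    isHorizontalLine_top

/-- Completeness of the descent. Beyond the first column, a rectangle reaching below `p` can be cut
in front of the column, so `β` is lower than `p.bottom`; and in its grid the next cell has a left
neighbor. -/
theorem exists_proceeds (h : Scan P B a p β) (hfin : P.baseRectangles.Finite)
    (hb : HasRect P B.left B.top a.right b) (hlt : b < p.bottom) :
    ∃ p', Proceeds P B a p p' β := by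
  have hb' := hb
  obtain ⟨R, hR, e1, e2, e3, e4⟩ := hb
  have h1 := p.left_lt_right
  have h2 := p.bottom_lt_top
  have h3 := h.left_le
  have h4 := h.left_eq
  have h5 := h.right_eq
  have h6 := h.top_le
  have hpR : p.Within R := within_of_overlaps hR h.mem_cell
    ⟨by linarith, by linarith, by linarith, by linarith⟩
  obtain ⟨p', hp', hpR', hs⟩ := exists_bottom_neighbor hfin hR h.mem_cell hpR (e4 ▸ hlt)
  refine ⟨p', hp', hs, h.previous.imp_right fun hprev => ⟨fun e => ?_, ?_⟩⟩
  · have := hprev.2.2 b (h.hasRect_left hfin hb' a.left_lt_right hprev.1)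
    linarith
  · have h7 := hs.2.1
    obtain ⟨q, hq, -, hs'⟩ := exists_left_neighbor hfin hR hp' hpR' (by linarith [hprev.1])
    exact ⟨q, hq, hs'⟩

/-- Soundness of the descent. The new rectangle is covered by the old one, the cell `p'` and, beyond
the first column, the rectangle `V` of the preceding column ending at `β`, cut at the bottom of the
left neighbor `q` of `p'`. The existence of `q` ensures that the bottom of `p'` is a grid line of
`V`. -/
theorem of_proceeds (h : Scan P B a p β) (hfin : P.baseRectangles.Finite)
    (hs : Proceeds P B a p p' β) : Scan P B a p' β := by
  obtain ⟨hp', ⟨s1, s2, s3⟩, hprev⟩ := hs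
  refine ⟨h.mem_corner, h.mem_column, hp', h.top_eq, s2.trans h.left_eq, s3.trans h.right_eq,
    h.hasRect_column, ?_, h.previous⟩
  obtain ⟨R, hR, e1, e2, e3, e4⟩ := h.hasRect_cell
  have h1 := p'.bottom_lt_top
  have h2 := R.bottom_lt_top
  have h3 := R.left_lt_right
  have h4 := h.left_eq
  have h5 := h.left_le
  have h6 := p'.left_lt_right
  have h7 := h.right_eq
  refine ⟨⟨B.left, B.top, p'.right, p'.bottom, by linarith, by linarith⟩, ?_, rfl, rfl, rfl, rfl⟩
  refine mem_powerset_of_cover fun z hz => ?_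
  obtain ⟨⟨z1, z2⟩, z3, z4⟩ := hz
  simp only at z1 z2 z3 z4
  by_cases hy : p.bottom ≤ z.2
  · refine ⟨R, hR, ⟨?_, ?_, ?_, ?_⟩, ⟨?_, ?_⟩, ?_, ?_⟩ <;> (try simp only) <;> linarith
  by_cases hx : a.left ≤ z.1
  · refine ⟨p', mem_powerset_of_mem hp', ⟨?_, ?_, ?_, ?_⟩, ⟨?_, ?_⟩, ?_, ?_⟩ <;>
      (try simp only) <;> linarith
  push Not at hx hy
  rcases h.previous with rfl | ⟨g1, g2, g3⟩
  · exact absurd z1 (by linarith)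
  obtain rfl | ⟨hβ, q, hq, q1, q2, q3⟩ := hprev
  · exact absurd z1 (by linarith)
  -- Minimality of `β` gives the weak inequality, which is why the program need only test equality.
  -- Strictness makes `q` overlap `V`, hence lie within it.
  have hβ' : β < p.bottom := lt_of_le_of_ne (g3 _ (h.hasRect_left hfin h.hasRect_cell
    (h4 ▸ p.left_lt_right) g1)) hβ.symm
  obtain ⟨V, hV, f1, f2, f3, f4⟩ := g2
  have h8 := V.left_lt_right
  have h9 := q.left_lt_right
  have h10 := q.bottom_lt_top
  have hqV : q.Within V := within_of_overlaps hV hq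
    ⟨by linarith, by linarith, by linarith, by linarith⟩
  obtain ⟨w1, w2, w3, w4⟩ := id hqV
  refine ⟨⟨V.left, V.top, V.right, q.bottom, h8, by linarith⟩,
    mem_powerset_of_within hfin hV ⟨le_rfl, le_rfl, w3, le_rfl⟩ isVerticalLine_left
      isVerticalLine_right (isHorizontalLine_of_mem hV hq hqV (Or.inl rfl))
      isHorizontalLine_top, ⟨?_, ?_, ?_, ?_⟩, ⟨?_, ?_⟩, ?_, ?_⟩ <;> (try simp only) <;> linarith

theorem exists_right (h : Scan P B a p β) (hfin : P.baseRectangles.Finite)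
    (hb : HasRect P B.left B.top r b) (hlt : a.right < r) :
    ∃ a' ∈ P.baseRectangles, a.SharesEdge .right a' := by
  obtain ⟨R, hR, e1, e2, e3, e4⟩ := hb
  have h1 := R.bottom_lt_top
  have h2 := a.left_lt_right
  have h3 := a.bottom_lt_top
  have h4 := h.top_eq
  have h5 := h.left_le
  have haR : a.Within R := within_of_overlaps hR h.mem_column
    ⟨by linarith, by linarith, by linarith, by linarith⟩
  obtain ⟨a', ha', -, hs⟩ := exists_right_neighbor hfin hR h.mem_column haR (e3 ▸ hlt)
  exact ⟨a', ha', hs⟩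

/-- The top row grows by the cell `a'`, of the same height as `a`. Since `p` is the lowest end of
the finished column, its bottom is the new `β`. -/
theorem of_right (h : Scan P B a p β)
    (hlow : ∀ b, HasRect P B.left B.top a.right b → p.bottom ≤ b)
    (ha' : a' ∈ P.baseRectangles) (hs : a.SharesEdge .right a') :
    Scan P B a' a' p.bottom := by
  obtain ⟨s1, s2, s3⟩ := hs
  have h1 := a.left_lt_right
  have h2 := h.left_le
  have h3 := a'.left_lt_right
  have h4 := a'.bottom_lt_top
  have h5 := h.top_eq
  have hc : HasRect P B.left B.top a'.right a'.bottom := by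
    obtain ⟨R, hR, e1, e2, e3, e4⟩ := h.hasRect_column
    refine ⟨⟨B.left, B.top, a'.right, a'.bottom, by linarith, by linarith⟩, ?_,
      rfl, rfl, rfl, rfl⟩
    refine mem_powerset_of_cover fun z hz => ?_
    obtain ⟨⟨z1, z2⟩, z3, z4⟩ := hz
    simp only at z1 z2 z3 z4
    by_cases hx : z.1 ≤ a.right
    · refine ⟨R, hR, ⟨?_, ?_, ?_, ?_⟩, ⟨?_, ?_⟩, ?_, ?_⟩ <;> (try simp only) <;> linarith
    · refine ⟨a', mem_powerset_of_mem ha', ⟨?_, ?_, ?_, ?_⟩, ⟨?_, ?_⟩, ?_, ?_⟩ <;>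
        (try simp only) <;> linarith
  refine ⟨h.mem_corner, ha', ha', s3.trans h5, rfl, rfl, hc, hc, Or.inr ⟨by linarith, ?_, ?_⟩⟩
  · rw [s1, ← h.right_eq]; exact h.hasRect_cell
  · rw [s1]; exact hlow

end Scan

/-! ### The rectangles that precede the current one -/

/-- The rectangles of the powerset with the top-left vertex of `B`. -/
def atCorner (P : Polygon) (B : Rect) : Set Rect :=
  {R | R ∈ powerset P.baseRectangles ∧ R.left = B.left ∧ R.top = B.top}

/-- The rectangles at the corner `B` that precede the cell `p` of column `a`. -/
def beforeCell (P : Polygon) (B a p : Rect) : Set Rect :=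
  {R | R ∈ atCorner P B ∧ (R.right < a.right ∨ R.right = a.right ∧ p.bottom < R.bottom)}

theorem beforeCell_corner (hB : B ∈ P.baseRectangles) : beforeCell P B B B = ∅ := by
  refine Set.eq_empty_of_forall_notMem ?_
  rintro R ⟨⟨hR, e1, e2⟩, h⟩
  have h1 := R.left_lt_right
  have h2 := R.bottom_lt_top
  have h3 := B.left_lt_right
  have h4 := B.bottom_lt_top
  obtain ⟨w1, w2, w3, w4⟩ := within_of_overlaps hR hB
    ⟨by linarith, by linarith, by linarith, by linarith⟩
  rcases h with h | h <;> linarith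

/-- No rectangle is skipped: one that ends in this column below `p` overlaps `p'`, so it contains
`p'` and ends no higher than it. -/
theorem Scan.beforeCell_down (h : Scan P B a p β) (hs : Proceeds P B a p p' β)
    (hR : R ∈ atCorner P B) (hr : R.right = p.right) (hb : R.bottom = p.bottom) :
    beforeCell P B a p' = insert R (beforeCell P B a p) := by
  obtain ⟨hp', ⟨s1, s2, s3⟩, -⟩ := hs
  have h1 := p'.bottom_lt_top
  have h2 := p'.left_lt_right
  have h3 := h.left_le
  have h4 := h.left_eq
  have h5 := h.right_eq
  ext Q
  simp only [Set.mem_insert_iff]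
  constructor
  · rintro ⟨hQ, hQ' | ⟨hQ1, hQ2⟩⟩
    · exact Or.inr ⟨hQ, Or.inl hQ'⟩
    rcases lt_or_ge p.bottom Q.bottom with hlt | hge
    · exact Or.inr ⟨hQ, Or.inr ⟨hQ1, hlt⟩⟩
    left
    obtain ⟨hQm, e1, e2⟩ := hQ
    obtain ⟨-, f1, f2⟩ := hR
    refine Rect.ext (by linarith) (by linarith) (by linarith) ?_
    by_contra hne
    have hlt : Q.bottom < p.bottom := lt_of_le_of_ne hge fun e => hne (e.trans hb.symm)
    have h6 := h.top_le
    have h7 := p.bottom_lt_top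
    have := within_of_overlaps hQm hp' ⟨by linarith, by linarith, by linarith, by linarith⟩
    linarith [this.2.2.1]
  · rintro (rfl | ⟨hQ, hQ' | ⟨hQ1, hQ2⟩⟩)
    · exact ⟨hR, Or.inr ⟨by linarith, by linarith⟩⟩
    · exact ⟨hQ, Or.inl hQ'⟩
    · exact ⟨hQ, Or.inr ⟨hQ1, by linarith⟩⟩

theorem eq_or_mem_beforeCell (hlow : ∀ b, HasRect P B.left B.top a.right b → p.bottom ≤ b)
    (hR : R ∈ atCorner P B) (hr : R.right = a.right) (hb : R.bottom = p.bottom)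
    (hA : A ∈ atCorner P B) (hle : A.right ≤ a.right) : A = R ∨ A ∈ beforeCell P B a p := by
  rcases hle.lt_or_eq with h | h
  · exact Or.inr ⟨hA, Or.inl h⟩
  have hle' := hlow A.bottom ⟨A, hA.1, hA.2.1, hA.2.2, h, rfl⟩
  rcases hle'.lt_or_eq with h' | h'
  · exact Or.inr ⟨hA, Or.inr ⟨h, h'⟩⟩
  · exact Or.inl (Rect.ext (hA.2.1.trans hR.2.1.symm) (hA.2.2.trans hR.2.2.symm)
      (h.trans hr.symm) (h'.symm.trans hb.symm))

/-- A rectangle extending to the right of `a` overlaps `a'`, hence contains it, so no right end lies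
strictly between the two columns and none in the new column ends above `a'`. -/
theorem Scan.beforeCell_right (h : Scan P B a p β)
    (hlow : ∀ b, HasRect P B.left B.top a.right b → p.bottom ≤ b)
    (ha' : a' ∈ P.baseRectangles) (hs : a.SharesEdge .right a')
    (hR : R ∈ atCorner P B) (hr : R.right = p.right) (hb : R.bottom = p.bottom) :
    beforeCell P B a' a' = insert R (beforeCell P B a p) := by
  obtain ⟨s1, s2, s3⟩ := hs
  have h1 := a'.bottom_lt_top
  have h2 := a'.left_lt_right
  have h3 := h.left_le
  have h4 := h.right_eq
  have h5 := h.top_eq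
  have h6 := a.left_lt_right
  ext Q
  simp only [Set.mem_insert_iff]
  constructor
  · rintro ⟨hQ, hQ'⟩
    refine eq_or_mem_beforeCell hlow hR (hr.trans h4) hb hQ ?_
    by_contra! hlt
    obtain ⟨hQm, e1, e2⟩ := hQ
    have h7 := Q.bottom_lt_top
    have := within_of_overlaps hQm ha' ⟨by linarith, by linarith, by linarith, by linarith⟩
    obtain ⟨w1, w2, w3, w4⟩ := this
    rcases hQ' with hQ' | hQ' <;> linarith
  · rintro (rfl | ⟨hQ, hQ' | ⟨hQ1, hQ2⟩⟩)
    · exact ⟨hR, Or.inl (by linarith)⟩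
    · exact ⟨hQ, Or.inl (by linarith)⟩
    · exact ⟨hQ, Or.inl (by linarith)⟩

theorem Scan.atCorner_eq (h : Scan P B a p β) (hfin : P.baseRectangles.Finite)
    (hlow : ∀ b, HasRect P B.left B.top a.right b → p.bottom ≤ b)
    (hright : ∀ a' ∈ P.baseRectangles, ¬ a.SharesEdge .right a')
    (hR : R ∈ atCorner P B) (hr : R.right = p.right) (hb : R.bottom = p.bottom) :
    atCorner P B = insert R (beforeCell P B a p) := by
  ext Q
  simp only [Set.mem_insert_iff]
  constructor
  · intro hQ
    refine eq_or_mem_beforeCell hlow hR (hr.trans h.right_eq) hb hQ ?_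
    by_contra! hlt
    obtain ⟨a', ha', hs⟩ := h.exists_right hfin
      ⟨Q, hQ.1, hQ.2.1, hQ.2.2, rfl, rfl⟩ hlt
    exact hright a' ha' hs
  · rintro (rfl | hQ)
    · exact hR
    · exact hQ.1

variable {N : ℕ} (node : Fin N → Rect)

/-- The rectangles at the corners with index less than `k`. -/
def beforeCorner (P : Polygon) (k : ℕ) : Set Rect :=
  {R | ∃ i : Fin N, i.1 < k ∧ R ∈ atCorner P (node i)}

theorem beforeCorner_zero : beforeCorner node P 0 = ∅ :=
  Set.eq_empty_of_forall_notMem fun _ ⟨_, h, _⟩ => Nat.not_lt_zero _ h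

theorem beforeCorner_succ (j : Fin N) :
    beforeCorner node P (j + 1) = beforeCorner node P j ∪ atCorner P (node j) := by
  ext R
  constructor
  · rintro ⟨i, hi, hR⟩
    rcases Nat.lt_succ_iff_lt_or_eq.1 hi with h | h
    · exact Or.inl ⟨i, h, hR⟩
    · exact Or.inr (Fin.ext h ▸ hR)
  · rintro (⟨i, hi, hR⟩ | hR)
    · exact ⟨i, hi.trans (Nat.lt_succ_self _), hR⟩
    · exact ⟨j, Nat.lt_succ_self _, hR⟩

theorem beforeCorner_last (hnode : Set.range node = P.baseRectangles) :
    beforeCorner node P N = powerset P.baseRectangles := by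
  ext R
  constructor
  · rintro ⟨i, -, hR⟩
    exact hR.1
  · intro hR
    obtain ⟨B, hB, -, h1, h2⟩ := exists_corner hR
    rw [← hnode] at hB
    obtain ⟨i, rfl⟩ := hB
    exact ⟨i, i.2, hR, h1.symm, h2.symm⟩

/-- No repetition: distinct nodes have distinct top-left vertices, and at one corner the order of
the scan is strict. -/
theorem notMem_before (hnode : Set.range node = P.baseRectangles)
    (hinj : Function.Injective node) {j : Fin N} (hR : R ∈ atCorner P (node j))
    (hr : R.right = a.right) (hb : R.bottom = p.bottom) :
    R ∉ beforeCorner node P j ∪ beforeCell P (node j) a p := by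
  rintro (⟨i, hi, hR'⟩ | ⟨-, h | h⟩)
  · have := eq_of_corner_eq (P := P) (hnode ▸ Set.mem_range_self i) (hnode ▸ Set.mem_range_self j)
      (hR'.2.1.symm.trans hR.2.1) (hR'.2.2.symm.trans hR.2.2)
    exact hi.ne (congrArg Fin.val (hinj this))
  · exact h.ne hr
  · exact h.2.ne hb.symm

end Polygon

end RectCover

/-! ### The program, its invariants and its running time -/

namespace RectCover

/-! ### The program -/

/-- The enumeration program. The integer registers `1` to `5` hold the number of nodes, the index
and the address of the corner node, and the addresses of the top of the current column and of the
current cell; register `0` stays null. -/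
def enumerate : Program :=
  [.load 1 0 0,
   .addConst 3 0 1,
   -- next corner
   .jumpEq 2 1 26,
   .addConst 4 3 0,
   .addConst 5 3 0,
   .loadReal 0 3 0,
   .loadReal 1 3 1,
   -- next cell
   .loadReal 2 5 2,
   .loadReal 3 5 3,
   .report 0 1 2 3,
   .load 6 5 3,
   .jumpEq 6 0 18,
   -- In the first column there is no preceding one: real register `4` holds a stale value, and both
   -- further tests are bypassed.
   .jumpEq 4 3 16,
   .jumpRealEq 3 4 18,
   .load 7 6 0,
   .jumpEq 7 0 18,
   .addConst 5 6 0,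
   .jump 7,
   -- next column
   .moveReal 4 3,
   .load 4 4 2,
   .jumpEq 4 0 23,
   .addConst 5 4 0,
   .jump 7,
   .addConst 2 2 1,
   .addConst 3 3 4,
   .jump 2]

/-- Within `k` steps the program gets from `σ` to a configuration with property `Q`. -/
def Reach (σ : Config) (k : ℕ) (Q : Config → Prop) : Prop :=
  ∃ t ≤ k, ∃ τ, Steps enumerate t σ τ ∧ Q τ

theorem Reach.done {σ : Config} {k : ℕ} {Q : Config → Prop} (h : Q σ) : Reach σ k Q :=
  ⟨0, Nat.zero_le _, σ, .refl σ, h⟩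

theorem Reach.step {σ : Config} {k : ℕ} {Q : Config → Prop} {i : Instr}
    (fetch : enumerate[σ.pc]? = some i) (h : Reach (i.exec σ) k Q) : Reach σ (k + 1) Q := by
  obtain ⟨t, ht, τ, hτ, hQ⟩ := h
  exact ⟨t + 1, Nat.succ_le_succ ht, τ, .step fetch hτ, hQ⟩

theorem Reach.jumpEq {σ : Config} {k : ℕ} {Q : Config → Prop} {a b l : ℕ}
    (fetch : enumerate[σ.pc]? = some (.jumpEq a b l)) (e : σ.intReg a = σ.intReg b)
    (h : Reach { σ with pc := l } k Q) : Reach σ (k + 1) Q :=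
  .step fetch (by rwa [Instr.exec, if_pos e])

theorem Reach.jumpEq_of_ne {σ : Config} {k : ℕ} {Q : Config → Prop} {a b l : ℕ}
    (fetch : enumerate[σ.pc]? = some (.jumpEq a b l)) (e : σ.intReg a ≠ σ.intReg b)
    (h : Reach { σ with pc := σ.pc + 1 } k Q) : Reach σ (k + 1) Q :=
  .step fetch (by rwa [Instr.exec, if_neg e])

theorem Reach.jumpRealEq {σ : Config} {k : ℕ} {Q : Config → Prop} {a b l : ℕ}
    (fetch : enumerate[σ.pc]? = some (.jumpRealEq a b l)) (e : σ.realReg a = σ.realReg b)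
    (h : Reach { σ with pc := l } k Q) : Reach σ (k + 1) Q :=
  .step fetch (by rwa [Instr.exec, if_pos e])

theorem Reach.jumpRealEq_of_ne {σ : Config} {k : ℕ} {Q : Config → Prop} {a b l : ℕ}
    (fetch : enumerate[σ.pc]? = some (.jumpRealEq a b l)) (e : σ.realReg a ≠ σ.realReg b)
    (h : Reach { σ with pc := σ.pc + 1 } k Q) : Reach σ (k + 1) Q :=
  .step fetch (by rwa [Instr.exec, if_neg e])

theorem Steps.trans {p : Program} {s t : ℕ} {σ τ υ : Config} (h : Steps p s σ τ)
    (h' : Steps p t τ υ) : Steps p (s + t) σ υ := by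
  induction h with
  | refl => rwa [Nat.zero_add]
  | step fetch _ ih => rw [Nat.add_right_comm]; exact .step fetch (ih h')

theorem Reach.trans {σ : Config} {k l : ℕ} {Q Q' : Config → Prop} (h : Reach σ k Q)
    (h' : ∀ τ, Q τ → Reach τ l Q') : Reach σ (k + l) Q' := by
  obtain ⟨s, hs, τ, hτ, hQ⟩ := h
  obtain ⟨t, ht, υ, hυ, hQ'⟩ := h' τ hQ
  exact ⟨s + t, Nat.add_le_add hs ht, υ, hτ.trans hυ, hQ'⟩

theorem Reach.mono {σ : Config} {k l : ℕ} {Q : Config → Prop} (h : Reach σ k Q) (hkl : k ≤ l) :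
    Reach σ l Q := by
  obtain ⟨s, hs, τ, hτ, hQ⟩ := h
  exact ⟨s, hs.trans hkl, τ, hτ, hQ⟩

open _root_.RectCover.Polygon

/-- The memory contains the base rectangle graph of `P`, with the given order of its nodes. -/
structure Stores (P : Polygon) (N : ℕ) (node : Fin N → Rect) (ints : ℕ → ℕ) (reals : ℕ → ℝ) :
    Prop where
  size : ints 0 = N
  injective : Function.Injective node
  range_eq : Set.range node = P.baseRectangles
  coord : ∀ (j : Fin N) (s : Side), reals (address j + s.offset) = (node j).coord s
  neighbor : ∀ (j : Fin N) (s : Side),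
    (∃ j' : Fin N, (node j).SharesEdge s (node j') ∧ ints (address j + s.offset) = address j') ∨
      ((∀ j' : Fin N, ¬ (node j).SharesEdge s (node j')) ∧ ints (address j + s.offset) = 0)

variable {P : Polygon} {N : ℕ} {node : Fin N → Rect} {ints : ℕ → ℕ} {reals : ℕ → ℝ}

theorem address_ne_zero (j : ℕ) : address j ≠ 0 := Nat.succ_ne_zero _

namespace Stores

theorem finite (h : Stores P N node ints reals) : P.baseRectangles.Finite :=
  h.range_eq ▸ Set.finite_range node

theorem node_mem (h : Stores P N node ints reals) (j : Fin N) : node j ∈ P.baseRectangles :=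
  h.range_eq ▸ Set.mem_range_self j

theorem not_sharesEdge (h : Stores P N node ints reals) {j : Fin N} {s : Side}
    (h' : ∀ j', ¬ (node j).SharesEdge s (node j')) {B : Rect} (hB : B ∈ P.baseRectangles) :
    ¬ (node j).SharesEdge s B := by
  rw [← h.range_eq] at hB
  obtain ⟨j', rfl⟩ := hB
  exact h' j'

/-- This lets a comparison of addresses decide whether the scan is in the first column. -/
theorem node_eq_iff (h : Stores P N node ints reals) {i j : Fin N} :
    node i = node j ↔ address i = address j := by
  rw [h.injective.eq_iff, Fin.ext_iff, address, address]
  omega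

end Stores

/-- The rectangles of `T` have been reported, each once. -/
def Reported (T : Set Rect) (σ : Config) : Prop :=
  σ.output.Nodup ∧ {o | o ∈ σ.output} = Rect.toPair '' T

theorem toPair_injective : Function.Injective Rect.toPair := by
  intro A B h
  simp only [Rect.toPair, Prod.mk.injEq] at h
  exact Rect.ext h.1.1 h.1.2 h.2.1 h.2.2

theorem Reported.cons {T : Set Rect} {σ τ : Config} (h : Reported T σ) {R : Rect} (hR : R ∉ T)
    (hτ : τ.output = R.toPair :: σ.output) : Reported (insert R T) τ := by
  refine ⟨?_, ?_⟩
  · rw [hτ, List.nodup_cons]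
    refine ⟨fun hmem => ?_, h.1⟩
    have : R.toPair ∈ Rect.toPair '' T := h.2 ▸ hmem
    obtain ⟨A, hA, e⟩ := this
    exact hR (toPair_injective e ▸ hA)
  · rw [Set.image_insert_eq, ← h.2, hτ]
    ext o
    simp

theorem Reported.length_eq {T : Set Rect} {σ : Config} (h : Reported T σ) :
    σ.output.length = T.ncard := by
  classical
  rw [← Set.ncard_image_of_injective T toPair_injective, ← h.2, ← List.toFinset_card_of_nodup h.1,
    ← Set.ncard_coe_finset]
  congr 1
  ext o
  simp

/-- The memory is unchanged, and `j` is the current corner. -/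
structure Registers (N : ℕ) (ints : ℕ → ℕ) (reals : ℕ → ℝ) (j : ℕ) (σ : Config) : Prop where
  ints_eq : σ.ints = ints
  reals_eq : σ.reals = reals
  null : σ.intReg 0 = 0
  size : σ.intReg 1 = N
  index : σ.intReg 2 = j
  corner : σ.intReg 3 = address j

/-- The program is about to treat the corner with index `j`. -/
structure AtCorner (P : Polygon) (node : Fin N → Rect) (ints : ℕ → ℕ) (reals : ℕ → ℝ) (j : ℕ)
    (σ : Config) : Prop where
  pc : σ.pc = 2
  registers : Registers N ints reals j σ
  le : j ≤ N
  reported : Reported (beforeCorner node P j) σ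

/-- The program is about to report the rectangle from the corner `j` to the cell `p` in the column
of `a`. -/
structure AtCell (P : Polygon) (node : Fin N → Rect) (ints : ℕ → ℕ) (reals : ℕ → ℝ)
    (j a p : Fin N) (σ : Config) : Prop where
  pc : σ.pc = 7
  registers : Registers N ints reals j σ
  column : σ.intReg 4 = address a
  cell : σ.intReg 5 = address p
  left : σ.realReg 0 = (node j).left
  top : σ.realReg 1 = (node j).top
  scan : Scan P (node j) (node a) (node p) (σ.realReg 4)
  reported : Reported (beforeCorner node P j ∪ beforeCell P (node j) (node a) (node p)) σ

/-- The program has finished the column of `a` with the cell `p`. -/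
structure AtColumnEnd (P : Polygon) (node : Fin N → Rect) (ints : ℕ → ℕ) (reals : ℕ → ℝ)
    (j a p : Fin N) (σ : Config) : Prop where
  pc : σ.pc = 18
  registers : Registers N ints reals j σ
  column : σ.intReg 4 = address a
  left : σ.realReg 0 = (node j).left
  top : σ.realReg 1 = (node j).top
  bottom : σ.realReg 3 = (node p).bottom
  scan : Scan P (node j) (node a) (node p) (σ.realReg 4)
  lowest : ∀ b, HasRect P (node j).left (node j).top (node a).right b → (node p).bottom ≤ b
  reported : ∀ R ∈ atCorner P (node j), R.right = (node p).right → R.bottom = (node p).bottom →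
    Reported (beforeCorner node P j ∪ insert R (beforeCell P (node j) (node a) (node p))) σ

theorem AtColumnEnd.reach {j a p : Fin N} {σ : Config} (hs : Stores P N node ints reals)
    (h : AtColumnEnd P node ints reals j a p σ) :
    Reach σ 6 fun τ => τ.output = σ.output ∧
      ((∃ a', AtCell P node ints reals j a' a' τ) ∨ AtCorner P node ints reals (j + 1) τ) := by
  obtain ⟨hpc, ⟨hi, hr, h0, h1, h2, h3⟩, h4, hl, ht, hb, hscan, hlow, hrep⟩ := h
  obtain ⟨pc, I, X, ints', reals', out⟩ := σ
  dsimp only at hpc hi hr h0 h1 h2 h3 h4 hl ht hb hscan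
  subst hpc hi hr
  obtain ⟨R, hR, e1, e2, e3, e4⟩ := hscan.hasRect_cell
  have hRc : R ∈ atCorner P (node j) := ⟨hR, e1, e2⟩
  have hrep := hrep R hRc e3 e4
  have hn := hs.neighbor a .right
  simp only [Side.offset] at hn
  refine .step (i := .moveReal 4 3) rfl ?_
  refine .step (i := .load 4 4 2) rfl ?_
  rcases hn with ⟨a', hsh, ha'⟩ | ⟨hno, ha'⟩
  · refine .jumpEq_of_ne (a := 4) (b := 0) (l := 23) rfl
      (by simp [Instr.exec, h4, h0, ha', address_ne_zero]) ?_
    refine .step (i := .addConst 5 4 0) rfl ?_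
    refine .step (i := .jump 7) rfl ?_
    refine .done ⟨rfl, Or.inl ⟨a', rfl, ⟨rfl, rfl, ?_, ?_, ?_, ?_⟩, ?_, ?_, ?_, ?_, ?_, ?_⟩⟩
    · simpa [Instr.exec] using h0
    · simpa [Instr.exec] using h1
    · simpa [Instr.exec] using h2
    · simpa [Instr.exec] using h3
    · simp [Instr.exec, h4, ha']
    · simp [Instr.exec, h4, ha']
    · simpa [Instr.exec] using hl
    · simpa [Instr.exec] using ht
    · simpa [Instr.exec, hb] using hscan.of_right hlow (hs.node_mem a') hsh
    · rw [hscan.beforeCell_right hlow (hs.node_mem a') hsh hRc e3 e4]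
      exact hrep
  · refine .jumpEq (a := 4) (b := 0) (l := 23) rfl (by simp [Instr.exec, h4, h0, ha']) ?_
    refine .step (i := .addConst 2 2 1) rfl ?_
    refine .step (i := .addConst 3 3 4) rfl ?_
    refine .step (i := .jump 2) rfl ?_
    refine .done ⟨rfl, Or.inr ⟨rfl, ⟨rfl, rfl, ?_, ?_, ?_, ?_⟩, j.2, ?_⟩⟩
    · simpa [Instr.exec] using h0
    · simpa [Instr.exec] using h1
    · simpa [Instr.exec] using h2
    · simp [Instr.exec, h3, address]; ring
    · rw [beforeCorner_succ, hscan.atCorner_eq hs.finite hlow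
        (fun a' ha' => hs.not_sharesEdge hno ha') hRc e3 e4]
      exact hrep

theorem AtCell.reach {j a p : Fin N} {σ : Config} (hs : Stores P N node ints reals)
    (h : AtCell P node ints reals j a p σ) :
    Reach σ 11 fun τ => τ.output.length = σ.output.length + 1 ∧
      ((∃ p', AtCell P node ints reals j a p' τ) ∨ AtColumnEnd P node ints reals j a p τ) := by
  obtain ⟨hpc, ⟨hi, hr, h0, h1, h2, h3⟩, h4, h5, hl, ht, hscan, hrep⟩ := h
  obtain ⟨pc, I, X, ints', reals', out⟩ := σ
  dsimp only at hpc hi hr h0 h1 h2 h3 h4 h5 hl ht hscan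
  subst hpc hi hr
  have hrep' : ∀ R ∈ atCorner P (node j), R.right = (node p).right →
      R.bottom = (node p).bottom → ∀ τ : Config,
      τ.output = (((node j).left, (node j).top), ((node p).right, (node p).bottom)) :: out →
      Reported (beforeCorner node P j ∪
        insert R (beforeCell P (node j) (node a) (node p))) τ := by
    intro R hR e3 e4 τ hτ
    rw [Set.union_insert]
    refine hrep.cons (notMem_before node hs.range_eq hs.injective hR
      (e3.trans hscan.right_eq) e4) ?_
    rw [hτ, Rect.toPair, hR.2.1, hR.2.2, e3, e4]
  have hend : ∀ τ : Config, τ.pc = 18 → Registers N ints' reals' j τ →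
      τ.intReg 4 = address a → τ.realReg 0 = X 0 → τ.realReg 1 = X 1 →
      τ.realReg 3 = (node p).bottom → τ.realReg 4 = X 4 →
      τ.output = (((node j).left, (node j).top), ((node p).right, (node p).bottom)) :: out →
      (∀ q, ¬ Proceeds P (node j) (node a) (node p) q (X 4)) →
      AtColumnEnd P node ints' reals' j a p τ := by
    refine fun τ g0 g1 g4 x0 x1 x3 x4 ho hno => ⟨g0, g1, g4, x0.trans hl, x1.trans ht, x3,
      by rwa [x4], fun b hb => ?_, fun R hR e3 e4 => hrep' R hR e3 e4 τ ho⟩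
    -- Stopping is justified by completeness: a rectangle reaching lower would allow the scan to
    -- proceed.
    by_contra! hlt
    obtain ⟨q, hq⟩ := hscan.exists_proceeds hs.finite hb hlt
    exact hno q hq
  have hcell : ∀ (τ : Config) (q : Fin N), τ.pc = 7 → Registers N ints' reals' j τ →
      τ.intReg 4 = address a → τ.intReg 5 = address q → τ.realReg 0 = X 0 →
      τ.realReg 1 = X 1 → τ.realReg 4 = X 4 →
      τ.output = (((node j).left, (node j).top), ((node p).right, (node p).bottom)) :: out →
      Proceeds P (node j) (node a) (node p) (node q) (X 4) →
      AtCell P node ints' reals' j a q τ := by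
    refine fun τ q g0 g1 g4 g5 x0 x1 x4 ho hq => ⟨g0, g1, g4, g5, x0.trans hl, x1.trans ht,
      by rw [x4]; exact hscan.of_proceeds hs.finite hq, ?_⟩
    obtain ⟨R, hR, e1, e2, e3, e4⟩ := hscan.hasRect_cell
    rw [hscan.beforeCell_down hq ⟨hR, e1, e2⟩ e3 e4]
    exact hrep' R ⟨hR, e1, e2⟩ e3 e4 τ ho
  have hcr := hs.coord p .right
  have hcb := hs.coord p .bottom
  have hn := hs.neighbor p .bottom
  simp only [Side.offset, Rect.coord] at hcr hcb hn
  refine .step (i := .loadReal 2 5 2) rfl ?_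
  refine .step (i := .loadReal 3 5 3) rfl ?_
  refine .step (i := .report 0 1 2 3) rfl ?_
  refine .step (i := .load 6 5 3) rfl ?_
  rcases hn with ⟨q, hsh, hq⟩ | ⟨hno, hq⟩
  swap
  · refine .jumpEq (a := 6) (b := 0) (l := 18) rfl (by simp [Instr.exec, h5, h0, hq]) ?_
    refine .done ⟨rfl, Or.inr (hend _ rfl ⟨rfl, rfl, ?_, ?_, ?_, ?_⟩ ?_ ?_ ?_ ?_ ?_ ?_
      fun q' hq' => hs.not_sharesEdge hno hq'.1 hq'.2.1)⟩ <;> simp [Instr.exec, *]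
  refine .jumpEq_of_ne (a := 6) (b := 0) (l := 18) rfl
    (by simp [Instr.exec, h5, h0, hq, address_ne_zero]) ?_
  by_cases hja : address a = address j
  · refine .jumpEq (a := 4) (b := 3) (l := 16) rfl (by simp [Instr.exec, h3, h4, hja]) ?_
    refine .step (i := .addConst 5 6 0) rfl ?_
    refine .step (i := .jump 7) rfl ?_
    refine .done ⟨rfl, Or.inl ⟨q, hcell _ _ rfl ⟨rfl, rfl, ?_, ?_, ?_, ?_⟩ ?_ ?_ ?_ ?_ ?_ ?_
      ⟨hs.node_mem q, hsh, Or.inl (hs.node_eq_iff.2 hja)⟩⟩⟩ <;> simp [Instr.exec, *]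
  have hne : node a ≠ node j := fun e => hja (hs.node_eq_iff.1 e)
  refine .jumpEq_of_ne (a := 4) (b := 3) (l := 16) rfl (by simp [Instr.exec, h3, h4, hja]) ?_
  by_cases hX : (node p).bottom = X 4
  · refine .jumpRealEq (a := 3) (b := 4) (l := 18) rfl (by simp [Instr.exec, h5, hcb, hX]) ?_
    refine .done ⟨rfl, Or.inr (hend _ rfl ⟨rfl, rfl, ?_, ?_, ?_, ?_⟩ ?_ ?_ ?_ ?_ ?_ ?_
      fun q' hq' => hq'.2.2.elim hne fun h => h.1 hX)⟩ <;> simp [Instr.exec, *]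
  refine .jumpRealEq_of_ne (a := 3) (b := 4) (l := 18) rfl
    (by simp [Instr.exec, h5, hcb, hX]) ?_
  refine .step (i := .load 7 6 0) rfl ?_
  have hnl := hs.neighbor q .left
  simp only [Side.offset, add_zero] at hnl
  rcases hnl with ⟨l, hshl, hl'⟩ | ⟨hno, hl'⟩
  · refine .jumpEq_of_ne (a := 7) (b := 0) (l := 18) rfl
      (by simp [Instr.exec, h5, h0, hq, hl', address_ne_zero]) ?_
    refine .step (i := .addConst 5 6 0) rfl ?_
    refine .step (i := .jump 7) rfl ?_
    refine .done ⟨rfl, Or.inl ⟨q, hcell _ _ rfl ⟨rfl, rfl, ?_, ?_, ?_, ?_⟩ ?_ ?_ ?_ ?_ ?_ ?_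
      ⟨hs.node_mem q, hsh, Or.inr ⟨hX, node l, hs.node_mem l, hshl⟩⟩⟩⟩ <;> simp [Instr.exec, *]
  · refine .jumpEq (a := 7) (b := 0) (l := 18) rfl
      (by simp [Instr.exec, h5, h0, hq, hl']) ?_
    -- The test looked only at the stored neighbor `q`, but a bottom neighbor is unique.
    have hno' : ∀ q', ¬ Proceeds P (node j) (node a) (node p) q' (X 4) := by
      rintro q' ⟨hq', hsh', hprev⟩
      obtain ⟨-, r, hr, hr'⟩ := hprev.resolve_left hne
      exact hs.not_sharesEdge hno hr (sharesEdge_unique (hs.node_mem q) hq' hsh hsh' ▸ hr')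
    refine .done ⟨rfl, Or.inr (hend _ rfl ⟨rfl, rfl, ?_, ?_, ?_, ?_⟩ ?_ ?_ ?_ ?_ ?_ ?_ hno')⟩ <;>
      simp [Instr.exec, *]

/-- All rectangles have been reported, and the program has halted. -/
def Finished (P : Polygon) (σ : Config) : Prop :=
  enumerate[σ.pc]? = none ∧ Reported (powerset P.baseRectangles) σ

theorem AtCorner.reach {j : ℕ} {σ : Config} (hs : Stores P N node ints reals)
    (h : AtCorner P node ints reals j σ) :
    Reach σ 5 fun τ => τ.output = σ.output ∧
      ((∃ j a p, AtCell P node ints reals j a p τ) ∨ Finished P τ) := by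
  obtain ⟨hpc, ⟨hi, hr, h0, h1, h2, h3⟩, hle, hrep⟩ := h
  obtain ⟨pc, I, X, ints', reals', out⟩ := σ
  dsimp only at hpc hi hr h0 h1 h2 h3
  subst hpc hi hr
  rcases hle.lt_or_eq with hlt | rfl
  · lift j to Fin N using hlt
    have hcl := hs.coord j .left
    have hct := hs.coord j .top
    simp only [Side.offset, Rect.coord, add_zero] at hcl hct
    refine .jumpEq_of_ne (a := 2) (b := 1) (l := 26) rfl (by simp [h1, h2, j.2.ne]) ?_
    refine .step (i := .addConst 4 3 0) rfl ?_
    refine .step (i := .addConst 5 3 0) rfl ?_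
    refine .step (i := .loadReal 0 3 0) rfl ?_
    refine .step (i := .loadReal 1 3 1) rfl ?_
    have hrep' : Reported (beforeCorner node P j ∪ beforeCell P (node j) (node j) (node j))
        ⟨2, I, X, ints', reals', out⟩ := by
      rwa [beforeCell_corner (hs.node_mem j), Set.union_empty]
    refine .done ⟨rfl, Or.inl ⟨j, j, j, rfl, ⟨rfl, rfl, ?_, ?_, ?_, ?_⟩, ?_, ?_, ?_, ?_,
      Scan.init (hs.node_mem j), hrep'⟩⟩ <;> simp [Instr.exec, *]
  · refine .jumpEq (a := 2) (b := 1) (l := 26) rfl (by simp [h1, h2]) ?_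
    refine .done ⟨rfl, Or.inr ⟨rfl, ?_⟩⟩
    rw [beforeCorner_last node hs.range_eq] at hrep
    exact hrep

/-- Within a bounded number of steps, the program reports a rectangle and gets to another cell or
finishes. -/
theorem AtCell.reach_next {j a p : Fin N} {σ : Config} (hs : Stores P N node ints reals)
    (h : AtCell P node ints reals j a p σ) :
    Reach σ 22 fun τ => τ.output.length = σ.output.length + 1 ∧
      ((∃ j a p, AtCell P node ints reals j a p τ) ∨ Finished P τ) := by
  refine ((h.reach hs).trans (l := 11) ?_).mono le_rfl
  rintro τ ⟨ho, ⟨p', h'⟩ | h'⟩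
  · exact .done ⟨ho, Or.inl ⟨j, a, p', h'⟩⟩
  refine ((h'.reach hs).trans (l := 5) ?_).mono le_rfl
  rintro υ ⟨ho', ⟨a', hυ⟩ | hυ⟩
  · exact .done ⟨ho' ▸ ho, Or.inl ⟨j, a', a', hυ⟩⟩
  -- The longest route is cell, column end, corner, which gives `11 + 6 + 5 = 22`.
  refine ((hυ.reach hs).trans (l := 0) ?_).mono le_rfl
  rintro ω ⟨ho'', hω⟩
  exact .done ⟨by rw [ho'', ho', ho], hω⟩

/-- The rectangle of the current cell is still unreported. Hence the number of unreported rectangles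
bounds the remaining visits to cells, and it serves as the induction parameter of
`AtCell.reach_finished`. -/
theorem AtCell.length_lt {j a p : Fin N} {σ : Config} (hs : Stores P N node ints reals)
    (h : AtCell P node ints reals j a p σ) :
    σ.output.length < (powerset P.baseRectangles).ncard := by
  rw [h.reported.length_eq]
  refine Set.ncard_lt_ncard ?_ (finite_powerset hs.finite)
  obtain ⟨R, hR, e1, e2, e3, e4⟩ := h.scan.hasRect_cell
  refine (Set.ssubset_iff_of_subset ?_).2 ⟨R, hR, notMem_before node hs.range_eq hs.injective
    ⟨hR, e1, e2⟩ (e3.trans h.scan.right_eq) e4⟩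
  rintro Q (⟨i, -, hQ⟩ | hQ)
  · exact hQ.1
  · exact hQ.1.1

theorem AtCell.reach_finished (hs : Stores P N node ints reals) (n : ℕ) :
    ∀ {j a p : Fin N} {σ : Config}, AtCell P node ints reals j a p σ →
      (powerset P.baseRectangles).ncard ≤ σ.output.length + n →
      Reach σ (22 * n) (Finished P) := by
  induction n with
  | zero => exact fun h hn => absurd (h.length_lt hs) hn.not_gt
  | succ n ih =>
    intro j a p σ h hn
    refine ((h.reach_next hs).trans (l := 22 * n) ?_).mono (by omega)
    rintro τ ⟨ho, ⟨j', a', p', h'⟩ | h'⟩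
    · exact ih h' (by omega)
    · exact .done h'

theorem reach_finished (hs : Stores P N node ints reals) :
    Reach (Config.init ints reals) (2 + (5 + 22 * (powerset P.baseRectangles).ncard))
      (Finished P) := by
  have h0 : Reach (Config.init ints reals) 2 (AtCorner P node ints reals 0) := by
    refine .step (i := .load 1 0 0) rfl ?_
    refine .step (i := .addConst 3 0 1) rfl ?_
    refine .done ⟨rfl, ⟨rfl, rfl, rfl, hs.size, rfl, rfl⟩, Nat.zero_le _, ?_⟩
    rw [beforeCorner_zero]
    exact ⟨List.nodup_nil, by ext; simp [Instr.exec, Config.init]⟩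
  refine h0.trans fun τ h => (h.reach hs).trans ?_
  rintro υ ⟨-, ⟨j, a, p, h'⟩ | h'⟩
  · exact AtCell.reach_finished hs _ h' (Nat.le_add_left _ _)
  · exact .done h'

end RectCover

theorem mainTheorem9 :
    ∃ (p : RectCover.Program) (C : ℕ),
      ∀ (P : RectCover.Polygon) (ints : ℕ → ℕ) (reals : ℕ → ℝ),
        RectCover.StoresBaseRectangleGraph P ints reals →
        ∃ (t : ℕ) (τ : RectCover.Config),
          RectCover.HaltsAfter p t (RectCover.Config.init ints reals) τ ∧
          τ.output.Nodup ∧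
          {o | o ∈ τ.output} =
            RectCover.Rect.toPair '' RectCover.powerset P.baseRectangles ∧
          t ≤ C * ((RectCover.powerset P.baseRectangles).ncard + 1) := by
  refine ⟨RectCover.enumerate, 22, fun P ints reals h => ?_⟩
  obtain ⟨N, node, h1, h2, h3, h4⟩ := h
  obtain ⟨t, ht, τ, hτ, hhalt, hrep⟩ := RectCover.reach_finished (P := P) (node := node)
    (ints := ints) (reals := reals)
    ⟨h1, h2, h3, fun j s => (h4 j s).1, fun j s => (h4 j s).2⟩
  exact ⟨t, τ, ⟨hτ, hhalt⟩, hrep.1, hrep.2, by omega⟩
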